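/- **Proposition (Perturbative version of the SGA equation).** Let $d\ge 0$, let $B_n=(\mathbb R^{*d})^n\times\mathbb R^d$, let $S_0(p_1,p_2,x)=x(p_1+p_2)$ on $B_2$, and let $S_n\in C^\infty(B_2)$ be real valued for $n\ge 1$. The formal series $S_h=\sum_{n\ge0}h^nS_n$ *satisfies the SGA (Symplectic Groupoid Associativity) equation* if, for all $(p_1,p_2,p_3,x)\in B_3$, $$S_h(p_1,p_2,\bar x)+S_h(\bar p,p_3,x)-\bar x\bar p=S_h(p_2,p_3,\tilde x)+S_h(p_1,\tilde p,x)-\tilde x\tilde p$$ as formal power series in $h$, where $\bar x,\bar p,\tilde x,\tilde p\in\mathbb R[[h]]^d$ are formal series solving $$\bar x=\nabla_{p_1}S_h(\bar p,p_3,x),\quad \bar p=\nabla_xS_h(p_1,p_2,\bar x),\quad \tilde x=\nabla_{p_2}S_h(p_1,\tilde p,x),\quad \tilde p=\nabla_xS_h(p_2,p_3,\tilde x).$$ Here a smooth function is evaluated at a formal series through its Taylor expansion at the constant term. For $k\ge1$ a *bipartite tree* $t$ with $|t|=k$ vertices is a tree (a connected graph without cycles) with vertex set $V_t=\{1,\dots,k\}$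 and edge set $E_t$, together with a colouring $\omega:V_t\to\{\circ,\bullet\}$ such that adjacent vertices have different colours; $T$ is the set of all of them (as labelled trees, not up to isomorphism). For $i\in\{1,2\}$ and $f_1,\dots,f_k\in C^\infty(B_2)$ put $$C^i_t(f_1,\dots,f_k)(p_1,p_2,p_3,x)=\sum_{\beta:E_t\to\{1,\dots,d\}}\ \prod_{v\in V_t}\Big[\Big(\prod_{e\in E_t,\ v\in e}D^{i,\omega(v)}_{\beta(e)}\Big)f_v\Big],$$ where * $D^{1,\circ}_a=\partial/\partial x^a$, with the result evaluated at $(p_1,p_2,x)$; * $D^{1,\bullet}_a=\partial/\partial (p_1)_a$ (first argument), with the result evaluated at $(p_1+p_2,p_3,x)$; * $D^{2,\circ}_a=\partial/\partial x^a$, with the result evaluated at $(p_2,p_3,x)$; * $D^{2,\bullet}_a=\partial/\partial (p_2)_a$ (second argument), with the result evaluated at $(p_1,p_2+p_3,x)$. Then $S_h=S_0+\sum_{n\ge1}h^nS_n$ satisfies the SGA equation if and only if for every $n>0$, identically on $B_3$, $$\sum_{\substack{t\in T\\|t|\le n}}\frac1{|t|!}\sum_{\substack{n_1+\dots+n_{|t|}=n\\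 n_i\ge1}}\Big(C^1_t(S_{n_1},\dots,S_{n_{|t|}})-C^2_t(S_{n_1},\dots,S_{n_{|t|}})\Big)=0 .$$ -/

import Mathlib

open scoped ContDiff Matrix Nat

noncomputable section

namespace SGA

/-- The space `B₂ = (ℝ*ᵈ)² × ℝᵈ`; its point `(p₁, p₂, x)` is `![p₁, p₂, x]`, so that slot `0` is `p₁`,
slot `1` is `p₂` and slot `2` is `x`. -/
abbrev B₂ (d : ℕ) : Type := Fin 3 → Fin d → ℝ

variable {d : ℕ}

/-- The partial derivative of `f` with respect to coordinate `c.2` of slot `c.1`. -/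
def partialDeriv (c : Fin 3 × Fin d) (f : B₂ d → ℝ) : B₂ d → ℝ :=
  fun y => fderiv ℝ f y (Pi.single c.1 (Pi.single c.2 1))

/-- The iterated partial derivative of `f` along a list of coordinates. For smooth `f` it does not
depend on the order of the list. -/
def mixedPartial (l : List (Fin 3 × Fin d)) (f : B₂ d → ℝ) : B₂ d → ℝ :=
  l.foldr partialDeriv f

/-! ### Substitution of formal series -/

/-- The constant term of a point of `B₂` with coordinates in `ℝ[[h]]`. -/
def constTerm (y : Fin 3 → Fin d → PowerSeries ℝ) : B₂ d :=
  fun s i => PowerSeries.constantCoeff (y s i)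

/-- The formal series `f(y)` for a smooth `f` and a point `y = y₀ + O(h)` with coordinates in
`ℝ[[h]]`, through the Taylor expansion
`f(y) = ∑ₘ (1/m!) ∑_{β₁,…,βₘ} (∂_{β₁}⋯∂_{βₘ} f)(y₀) (y - y₀)_{β₁} ⋯ (y - y₀)_{βₘ}`.
The terms with `m > n` do not contribute to the coefficient of `hⁿ`. -/
def taylorSubst (f : B₂ d → ℝ) (y : Fin 3 → Fin d → PowerSeries ℝ) : PowerSeries ℝ :=
  PowerSeries.mk fun n => ∑ m ∈ Finset.range (n + 1), ((m ! : ℕ) : ℝ)⁻¹ *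
    ∑ β : Fin m → Fin 3 × Fin d,
      mixedPartial (List.ofFn β) f (constTerm y) *
        PowerSeries.coeff n
          (∏ j, (y (β j).1 (β j).2 - PowerSeries.C (constTerm y (β j).1 (β j).2)))

/-- The formal series `S_h(y) = ∑ₙ hⁿ Sₙ(y)`. -/
def seriesSubst (S : ℕ → B₂ d → ℝ) (y : Fin 3 → Fin d → PowerSeries ℝ) : PowerSeries ℝ :=
  PowerSeries.mk fun n => ∑ ij ∈ Finset.HasAntidiagonal.antidiagonal n,
    PowerSeries.coeff ij.2 (taylorSubst (S ij.1) y)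

/-- The gradient of `S_h` with respect to the variables of slot `s`, evaluated at the formal
point `y`. -/
def seriesGrad (s : Fin 3) (S : ℕ → B₂ d → ℝ) (y : Fin 3 → Fin d → PowerSeries ℝ) :
    Fin d → PowerSeries ℝ :=
  fun i => seriesSubst (fun n => partialDeriv (s, i) (S n)) y

/-- A vector of `ℝᵈ` as a constant vector of formal series. -/
def const (v : Fin d → ℝ) : Fin d → PowerSeries ℝ := fun i => PowerSeries.C (v i)

/-- `S_h = ∑ₙ hⁿ Sₙ` satisfies the Symplectic Groupoid Associativity equation, as an identity of
formal series in `h` at every `(p₁, p₂, p₃, x) ∈ B₃`; `xb`, `pb`, `xt`, `pt` are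
`x̄`, `p̄`, `x̃`, `p̃`. -/
def Satisfies (S : ℕ → B₂ d → ℝ) : Prop :=
  ∀ p₁ p₂ p₃ x : Fin d → ℝ, ∃ xb pb xt pt : Fin d → PowerSeries ℝ,
    xb = seriesGrad 0 S ![pb, const p₃, const x] ∧
    pb = seriesGrad 2 S ![const p₁, const p₂, xb] ∧
    xt = seriesGrad 1 S ![const p₁, pt, const x] ∧
    pt = seriesGrad 2 S ![const p₂, const p₃, xt] ∧
    seriesSubst S ![const p₁, const p₂, xb] + seriesSubst S ![pb, const p₃, const x] - xb ⬝ᵥ pb =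
      seriesSubst S ![const p₂, const p₃, xt] + seriesSubst S ![const p₁, pt, const x] - xt ⬝ᵥ pt

/-! ### Bipartite Cayley trees -/

/-- The colours `∘` and `•`. -/
inductive Colour : Type
  | white
  | black
  deriving DecidableEq

instance : Fintype Colour := ⟨{.white, .black}, fun c => by cases c <;> simp⟩

/-- The bipartite trees with vertex set `{1, …, k}`. -/
def BipartiteTree (k : ℕ) : Type :=
  {t : SimpleGraph (Fin k) × (Fin k → Colour) //
    t.1.IsTree ∧ ∀ v w, t.1.Adj v w → t.2 v ≠ t.2 w}

/-- The underlying graph of a bipartite tree. -/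
def BipartiteTree.graph {k : ℕ} (t : BipartiteTree k) : SimpleGraph (Fin k) := t.1.1

/-- The colouring `ω` of a bipartite tree. -/
def BipartiteTree.colour {k : ℕ} (t : BipartiteTree k) : Fin k → Colour := t.1.2

open Classical in
instance (k : ℕ) : Fintype (BipartiteTree k) :=
  inferInstanceAs (Fintype {t : SimpleGraph (Fin k) × (Fin k → Colour) //
    t.1.IsTree ∧ ∀ v w, t.1.Adj v w → t.2 v ≠ t.2 w})

open Classical in
instance {k : ℕ} (t : BipartiteTree k) : Fintype t.graph.edgeSet := Fintype.ofFinite _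

/-- The two sides of the equation: `first` is expressed by `x̄, p̄`, `second` by `x̃, p̃`. -/
inductive Side : Type
  | first
  | second

/-- The slot with respect to which the function at a vertex of the given colour is differentiated:
`x` at a white vertex; at a black one `p₁` on the first side and `p₂` on the second. -/
def slot : Side → Colour → Fin 3
  | _, .white => 2
  | .first, .black => 0
  | .second, .black => 1

/-- The point of `B₂` at which the function at a vertex of the given colour is evaluated. -/
def basePoint (p₁ p₂ p₃ x : Fin d → ℝ) : Side → Colour → B₂ d
  | .first, .white => ![p₁, p₂, x]
  | .first, .black => ![p₁ + p₂, p₃, x]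
  | .second, .white => ![p₂, p₃, x]
  | .second, .black => ![p₁, p₂ + p₃, x]

open Classical in
/-- The list of the edges of `t` that contain the vertex `v`, in some order. -/
def BipartiteTree.edgesAt {k : ℕ} (t : BipartiteTree k) (v : Fin k) : List t.graph.edgeSet :=
  (Finset.univ.filter fun e : t.graph.edgeSet => v ∈ (e : Sym2 (Fin k))).toList

open Classical in
/-- The multidifferential map `C^i_t(f₁, …, f_k) : B₃ → ℝ`: the sum over all labellings
`β : E_t → {1, …, d}` of the edges of the product over the vertices `v` of the derivative of `f_v`
along the labels of the edges at `v`. -/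
def C (i : Side) {k : ℕ} (t : BipartiteTree k) (f : Fin k → B₂ d → ℝ)
    (p₁ p₂ p₃ x : Fin d → ℝ) : ℝ :=
  ∑ β : t.graph.edgeSet → Fin d, ∏ v : Fin k,
    mixedPartial ((t.edgesAt v).map fun e => (slot i (t.colour v), β e)) (f v)
      (basePoint p₁ p₂ p₃ x i (t.colour v))

/-- The tuples `(n₁, …, n_k)` with `n₁ + ⋯ + n_k = n` and all `nᵢ ≥ 1`. -/
def compositions (k n : ℕ) : Finset (Fin k → ℕ) :=
  (Finset.piAntidiag Finset.univ n).filter fun ν => ∀ v, 1 ≤ ν v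

end SGA

end

/-!
At a fixed point of `B₃`, the equations for `x̄, p̄` say that the increments of `x̄, p̄` over their
constant terms are a critical point of the formal function consisting of the quadratic form that
pairs the two colours and of the Taylor series of `∑_{n ≥ 1} hⁿ Sₙ` at the two base points. Since
`S₀` is bilinear, the left-hand side of the SGA equation is `x (p₁ + p₂ + p₃)` plus the critical
value; the same holds for `x̃, p̃` and the right-hand side.

Scale the jets of the formal function by a variable `X`. The critical value then satisfies a
Hamilton–Jacobi equation, whose `Xⁿ` coefficient is a recursion in which two smaller coefficients
are joined by an edge. The sum over the labelled trees on `n` vertices of their contractions,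
divided by `n!`, satisfies the same recursion, because cutting one of the `n - 1` edges of a tree
leaves two trees. Hence the critical value is this sum over trees, and the pairing of opposite
colours leaves only the bipartite ones.
-/

noncomputable section

namespace SGA

open PowerSeries

section Taylor

variable {κ : Type*} [Fintype κ] {A : Type*} [CommRing A]

/-- The homogeneous part of degree `m` (without the factor `1 / m!`) of the Taylor expansion with
jets `J`, evaluated at the increment `y`. -/
def taylorTerm (y : κ → A) : ℕ → (Multiset κ → A) → A
  | 0, J => J 0
  | m + 1, J => ∑ i, y i * taylorTerm y m fun l => J (i ::ₘ l)

theorem taylorTerm_succ (y : κ → A) (m : ℕ) (J : Multiset κ → A) :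
    taylorTerm y (m + 1) J = ∑ i, y i * taylorTerm y m fun l => J (i ::ₘ l) := rfl

theorem taylorTerm_sum {σ : Type*} (s : Finset σ) (y : κ → A) (m : ℕ) (J : σ → Multiset κ → A) :
    taylorTerm y m (fun l => ∑ c ∈ s, J c l) = ∑ c ∈ s, taylorTerm y m (J c) := by
  induction m generalizing J with
  | zero => rfl
  | succ m ih =>
    simp only [taylorTerm_succ, ih, Finset.mul_sum]
    exact Finset.sum_comm

theorem map_taylorTerm {B : Type*} [CommRing B] (θ : A →+* B) (y : κ → A) (m : ℕ)
    (J : Multiset κ → A) :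
    θ (taylorTerm y m J) = taylorTerm (fun i => θ (y i)) m fun l => θ (J l) := by
  induction m generalizing J with
  | zero => rfl
  | succ m ih => simp only [taylorTerm_succ, map_sum, map_mul, ih]

theorem derivation_taylorTerm_succ [Algebra ℚ A] (D : Derivation ℚ A A) (y : κ → A) (m : ℕ)
    (J : Multiset κ → A) :
    D (taylorTerm y (m + 1) J) = taylorTerm y (m + 1) (fun l => D (J l)) +
      (m + 1 : ℚ) • ∑ i, taylorTerm y m (fun l => J (i ::ₘ l)) * D (y i) := by
  induction m generalizing J with
  | zero => simp [taylorTerm, Finset.sum_add_distrib]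
  | succ m ih =>
    have regroup : ∑ i, y i * ∑ j, taylorTerm y m (fun l => J (i ::ₘ j ::ₘ l)) * D (y j) =
        ∑ j, taylorTerm y (m + 1) (fun l => J (j ::ₘ l)) * D (y j) := by
      simp_rw [Finset.mul_sum, taylorTerm_succ, Finset.sum_mul]
      rw [Finset.sum_comm]
      simp_rw [mul_assoc, Multiset.cons_swap]
    rw [taylorTerm_succ, map_sum]
    simp_rw [Derivation.leibniz, smul_eq_mul, ih, mul_add, mul_smul_comm, Finset.sum_add_distrib,
      ← Finset.smul_sum]
    rw [regroup, taylorTerm_succ y (m + 1) fun l => D (J l)]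
    simp_rw [mul_comm (taylorTerm y (m + 1) _) (D _)]
    push_cast
    module

theorem dvd_taylorTerm {a : A} (y : κ → A) (m : ℕ) {J : Multiset κ → A} (hJ : ∀ l, a ∣ J l) :
    a ∣ taylorTerm y m J := by
  induction m generalizing J with
  | zero => exact hJ 0
  | succ m ih => exact Finset.dvd_sum fun i _ => (ih fun l => hJ _).mul_left _

theorem pow_dvd_taylorTerm {a : A} {y : κ → A} (hy : ∀ i, a ∣ y i) (m : ℕ) (J : Multiset κ → A) :
    a ^ m ∣ taylorTerm y m J := by
  induction m generalizing J with
  | zero => simp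
  | succ m ih =>
    rw [pow_succ']
    exact Finset.dvd_sum fun i _ => mul_dvd_mul (hy i) (ih _)

theorem mul_dvd_taylorTerm_sub {a b : A} {y z : κ → A} (h : ∀ i, b ∣ y i - z i) (m : ℕ)
    {J : Multiset κ → A} (hJ : ∀ l, a ∣ J l) :
    b * a ∣ taylorTerm y m J - taylorTerm z m J := by
  induction m generalizing J with
  | zero => simp [taylorTerm]
  | succ m ih =>
    rw [taylorTerm_succ, taylorTerm_succ, ← Finset.sum_sub_distrib]
    refine Finset.dvd_sum fun i _ => ?_
    have split : y i * taylorTerm y m (fun l => J (i ::ₘ l)) -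
        z i * taylorTerm z m (fun l => J (i ::ₘ l)) =
        (y i - z i) * taylorTerm y m (fun l => J (i ::ₘ l)) +
        z i * (taylorTerm y m (fun l => J (i ::ₘ l)) - taylorTerm z m (fun l => J (i ::ₘ l))) := by
      ring
    rw [split]
    exact dvd_add (mul_dvd_mul (h i) (dvd_taylorTerm y m fun l => hJ _))
      ((ih fun l => hJ _).mul_left _)

/-- The Taylor polynomial of degree less than `N` with jets `J`, at the increment `y`. -/
def taylorPoly [Algebra ℚ A] (N : ℕ) (J : Multiset κ → A) (y : κ → A) : A :=
  ∑ m ∈ Finset.range N, (m ! : ℚ)⁻¹ • taylorTerm y m J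

variable [Algebra ℚ A]

theorem taylorPoly_sum {σ : Type*} (s : Finset σ) (N : ℕ) (J : σ → Multiset κ → A) (y : κ → A) :
    taylorPoly N (fun l => ∑ c ∈ s, J c l) y = ∑ c ∈ s, taylorPoly N (J c) y := by
  simp only [taylorPoly, taylorTerm_sum, Finset.smul_sum]
  exact Finset.sum_comm

theorem map_taylorPoly {B : Type*} [CommRing B] [Algebra ℚ B] (θ : A →ₐ[ℚ] B) (N : ℕ)
    (J : Multiset κ → A) (y : κ → A) :
    θ (taylorPoly N J y) = taylorPoly N (fun l => θ (J l)) fun i => θ (y i) := by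
  simp only [taylorPoly, map_sum, map_smul]
  exact Finset.sum_congr rfl fun m _ => congr_arg _ (map_taylorTerm (θ : A →+* B) y m J)

theorem derivation_taylorPoly_succ (D : Derivation ℚ A A) (N : ℕ) (J : Multiset κ → A)
    (y : κ → A) :
    D (taylorPoly (N + 1) J y) = taylorPoly (N + 1) (fun l => D (J l)) y +
      ∑ i, taylorPoly N (fun l => J (i ::ₘ l)) y * D (y i) := by
  have factorial_inv (m : ℕ) : ((m + 1)! : ℚ)⁻¹ * (m + 1 : ℚ) = (m ! : ℚ)⁻¹ := by
    rw [Nat.factorial_succ]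
    push_cast
    field_simp
  simp only [taylorPoly, Finset.sum_range_succ', map_add, map_sum, Derivation.map_smul,
    derivation_taylorTerm_succ, smul_add, smul_smul, factorial_inv, Finset.sum_add_distrib,
    Finset.sum_mul, Finset.smul_sum, smul_mul_assoc]
  rw [Finset.sum_comm (s := Finset.univ), add_right_comm]
  rfl

theorem mul_dvd_taylorPoly_sub {a b : A} {y z : κ → A} (h : ∀ i, b ∣ y i - z i) (N : ℕ)
    {J : Multiset κ → A} (hJ : ∀ l, a ∣ J l) :
    b * a ∣ taylorPoly N J y - taylorPoly N J z := by
  simp only [taylorPoly, ← Finset.sum_sub_distrib, ← smul_sub]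
  exact Finset.dvd_sum fun m _ => dvd_smul_of_dvd _ (mul_dvd_taylorTerm_sub h m hJ)

end Taylor

section XAdic

variable {A : Type*} [CommRing A]

theorem eq_of_forall_X_pow_dvd_sub {f g : A⟦X⟧} (h : ∀ n, X ^ n ∣ f - g) : f = g := by
  ext n
  have := X_pow_dvd_iff.1 (h (n + 1)) n n.lt_succ_self
  rwa [map_sub, sub_eq_zero] at this

theorem X_pow_dvd_map {B : Type*} [CommRing B] {θ : A⟦X⟧ →+* B⟦X⟧} (hθ : X ∣ θ X) {n : ℕ}
    {f : A⟦X⟧} (h : X ^ n ∣ f) : X ^ n ∣ θ f :=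
  (pow_dvd_pow_of_dvd hθ n).trans (map_pow θ X n ▸ map_dvd θ h)

theorem X_pow_dvd_derivation [Algebra ℚ A] {D : Derivation ℚ A⟦X⟧ A⟦X⟧} (hD : X ∣ D X) {n : ℕ}
    {f : A⟦X⟧} (h : X ^ n ∣ f) : X ^ n ∣ D f := by
  obtain ⟨g, rfl⟩ := h
  rw [Derivation.leibniz, Derivation.leibniz_pow, smul_eq_mul, smul_eq_mul, smul_eq_mul,
    mul_smul_comm]
  refine dvd_add (dvd_mul_right _ _) (dvd_smul_of_dvd n (Dvd.dvd.mul_left ?_ g))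
  rcases n with - | n
  · simp
  · exact pow_succ (X : A⟦X⟧) n ▸ mul_dvd_mul_left (X ^ n) hD

theorem exists_X_adic_limit (s : ℕ → A⟦X⟧) (hs : ∀ n, X ^ n ∣ s (n + 1) - s n) :
    ∃ f, ∀ n, X ^ n ∣ f - s n := by
  have cauchy {n m : ℕ} (h : n ≤ m) : X ^ n ∣ s m - s n := by
    induction m, h using Nat.le_induction with
    | base => simp
    | succ m hm ih =>
      exact sub_add_sub_cancel (s (m + 1)) (s m) (s n) ▸
        dvd_add ((pow_dvd_pow X hm).trans (hs m)) ih
  refine ⟨PowerSeries.mk fun n => coeff n (s (n + 1)), fun n => X_pow_dvd_iff.2 fun m hm => ?_⟩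
  have := X_pow_dvd_iff.1 (cauchy hm) m m.lt_succ_self
  rw [map_sub, sub_eq_zero] at this
  rw [map_sub, coeff_mk, this, sub_self]

theorem existsUnique_fixedPoint {κ : Type*} {Φ : (κ → A⟦X⟧) → κ → A⟦X⟧}
    (hΦ : ∀ n y z, (∀ k, X ^ n ∣ y k - z k) → ∀ k, X ^ (n + 1) ∣ Φ y k - Φ z k) :
    ∃! y, y = Φ y := by
  have iterates_cauchy (n : ℕ) : ∀ k, X ^ n ∣ Φ^[n + 1] 0 k - Φ^[n] 0 k := by
    induction n with
    | zero => simp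
    | succ n ih =>
      rw [Function.iterate_succ_apply' Φ (n + 1)]
      nth_rewrite 2 [Function.iterate_succ_apply']
      exact hΦ n _ _ ih
  choose y hy using fun k => exists_X_adic_limit (fun n => Φ^[n] 0 k) fun n => iterates_cauchy n k
  have fixed : y = Φ y := by
    funext k
    refine eq_of_forall_X_pow_dvd_sub fun n => (pow_dvd_pow X n.le_succ).trans ?_
    have close := hΦ n y _ (fun k => hy k n) k
    rw [← Function.iterate_succ_apply' Φ n] at close
    exact sub_sub_sub_cancel_right (y k) _ _ ▸ dvd_sub (hy k (n + 1)) close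
  refine ⟨y, fixed, fun z hz => funext fun k => eq_of_forall_X_pow_dvd_sub fun n => ?_⟩
  induction n generalizing k with
  | zero => simp
  | succ n ih =>
    have := hΦ n z y ih k
    rwa [← hz, ← fixed] at this

end XAdic

section FormalTaylor

variable {κ : Type*} [Fintype κ] {A : Type*} [CommRing A] [Algebra ℚ A]

/-- The Taylor series with jets `J` at the increment `y`, as a formal series; it is meaningful for
increments without constant term, for which Taylor terms of degree `m > n` do not contribute to the
coefficient of `Xⁿ`. -/
def formalTaylor (J : Multiset κ → A⟦X⟧) (y : κ → A⟦X⟧) : A⟦X⟧ :=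
  PowerSeries.mk fun n => coeff n (taylorPoly (n + 1) J y)

theorem formalTaylor_sum {σ : Type*} (s : Finset σ) (J : σ → Multiset κ → A⟦X⟧) (y : κ → A⟦X⟧) :
    formalTaylor (fun l => ∑ c ∈ s, J c l) y = ∑ c ∈ s, formalTaylor (J c) y := by
  ext n
  simp only [formalTaylor, taylorPoly_sum, coeff_mk, map_sum]

theorem formalTaylor_zero (J : Multiset κ → A⟦X⟧) : formalTaylor J 0 = J 0 := by
  ext n
  rw [formalTaylor, coeff_mk, taylorPoly, Finset.sum_range_succ']
  simp [taylorTerm]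

theorem X_dvd_formalTaylor {J : Multiset κ → A⟦X⟧} (hJ : ∀ l, X ∣ J l) (y : κ → A⟦X⟧) :
    X ∣ formalTaylor J y := by
  rw [X_dvd_iff, ← coeff_zero_eq_constantCoeff_apply, formalTaylor, coeff_mk, taylorPoly,
    coeff_zero_eq_constantCoeff_apply, ← X_dvd_iff]
  exact Finset.dvd_sum fun m _ => dvd_smul_of_dvd _ (dvd_taylorTerm y m hJ)

theorem X_pow_succ_dvd_formalTaylor_sub {n : ℕ} {y z : κ → A⟦X⟧} (h : ∀ i, X ^ n ∣ y i - z i)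
    {J : Multiset κ → A⟦X⟧} (hJ : ∀ l, X ∣ J l) :
    X ^ (n + 1) ∣ formalTaylor J y - formalTaylor J z := by
  rw [X_pow_dvd_iff]
  intro k hk
  have := X_pow_dvd_iff.1 (pow_succ (X : A⟦X⟧) n ▸ mul_dvd_taylorPoly_sub h (k + 1) hJ) k hk
  simpa only [formalTaylor, map_sub, coeff_mk] using this

variable {y : κ → A⟦X⟧} (hy : ∀ i, X ∣ y i)

include hy

theorem X_pow_dvd_formalTaylor_sub_taylorPoly (N : ℕ) (J : Multiset κ → A⟦X⟧) :
    X ^ N ∣ formalTaylor J y - taylorPoly N J y := by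
  rw [X_pow_dvd_iff]
  intro n hn
  rw [map_sub, formalTaylor, coeff_mk, taylorPoly, taylorPoly,
    ← Finset.sum_range_add_sum_Ico _ (Nat.succ_le_of_lt hn), map_add, sub_add_cancel_left,
    neg_eq_zero, map_sum]
  refine Finset.sum_eq_zero fun m hm => X_pow_dvd_iff.1 (dvd_smul_of_dvd _ ?_) n n.lt_succ_self
  exact (pow_dvd_pow _ (Finset.mem_Ico.1 hm).1).trans (pow_dvd_taylorTerm hy m J)

theorem map_formalTaylor {B : Type*} [CommRing B] [Algebra ℚ B] {θ : A⟦X⟧ →ₐ[ℚ] B⟦X⟧}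
    (hθ : X ∣ θ X) (J : Multiset κ → A⟦X⟧) :
    θ (formalTaylor J y) = formalTaylor (fun l => θ (J l)) fun i => θ (y i) := by
  refine eq_of_forall_X_pow_dvd_sub fun N => ?_
  have left := X_pow_dvd_map (θ := (θ : A⟦X⟧ →+* B⟦X⟧)) hθ
    (X_pow_dvd_formalTaylor_sub_taylorPoly hy N J)
  have right := X_pow_dvd_formalTaylor_sub_taylorPoly
    (fun i => hθ.trans (map_dvd θ (hy i))) N fun l => θ (J l)
  rw [RingHom.coe_coe, map_sub, map_taylorPoly] at left
  exact sub_sub_sub_cancel_right (θ (formalTaylor J y)) _ _ ▸ dvd_sub left right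

theorem derivation_formalTaylor {D : Derivation ℚ A⟦X⟧ A⟦X⟧} (hD : X ∣ D X)
    (J : Multiset κ → A⟦X⟧) :
    D (formalTaylor J y) = formalTaylor (fun l => D (J l)) y +
      ∑ i, formalTaylor (fun l => J (i ::ₘ l)) y * D (y i) := by
  refine eq_of_forall_X_pow_dvd_sub fun N => ?_
  have left := X_pow_dvd_derivation hD ((pow_dvd_pow X N.le_succ).trans
    (X_pow_dvd_formalTaylor_sub_taylorPoly hy (N + 1) J))
  have jets := (pow_dvd_pow X N.le_succ).trans
    (X_pow_dvd_formalTaylor_sub_taylorPoly hy (N + 1) fun l => D (J l))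
  have increments : X ^ N ∣ ∑ i, (formalTaylor (fun l => J (i ::ₘ l)) y -
      taylorPoly N (fun l => J (i ::ₘ l)) y) * D (y i) :=
    Finset.dvd_sum fun i _ => (X_pow_dvd_formalTaylor_sub_taylorPoly hy N _).mul_right _
  rw [map_sub, derivation_taylorPoly_succ] at left
  simp only [sub_mul, Finset.sum_sub_distrib] at increments
  convert dvd_sub (dvd_sub left jets) increments using 1
  ring

end FormalTaylor

section TaylorSums

variable {κ A : Type*} [Fintype κ] [CommRing A]

theorem taylorTerm_eq_sum (y : κ → A) (m : ℕ) (J : Multiset κ → A) :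
    taylorTerm y m J = ∑ γ : Fin m → κ, J (List.ofFn γ : List κ) * ∏ j, y (γ j) := by
  induction m generalizing J with
  | zero => simp [taylorTerm]
  | succ m ih =>
    rw [taylorTerm_succ, ← (Fin.consEquiv fun _ => κ).sum_comp, Fintype.sum_prod_type]
    refine Finset.sum_congr rfl fun i _ => ?_
    rw [ih, Finset.mul_sum]
    refine Finset.sum_congr rfl fun γ _ => ?_
    rw [show Fin.consEquiv (fun _ => κ) (i, γ) = Fin.cons i γ from rfl, List.ofFn_cons,
      Fin.prod_univ_succ, Multiset.cons_coe, mul_left_comm]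
    rfl

theorem taylorTerm_comp_prodMk {τ : Type*} [Fintype τ] {y : τ × κ → A} {c : τ}
    (hy : ∀ c' i, c' ≠ c → y (c', i) = 0) (m : ℕ) (J : Multiset (τ × κ) → A) :
    taylorTerm y m J = taylorTerm (fun i => y (c, i)) m fun l => J (l.map (Prod.mk c)) := by
  classical
  induction m generalizing J with
  | zero => rfl
  | succ m ih =>
    rw [taylorTerm_succ, Fintype.sum_prod_type, Fintype.sum_eq_single c]
    · simp only [taylorTerm_succ, ih, Multiset.map_cons]
    · exact fun c' h => Finset.sum_eq_zero fun i _ => by rw [hy c' i h, zero_mul]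

variable [Algebra ℚ A]

theorem formalTaylor_add (J J' : Multiset κ → A⟦X⟧) (y : κ → A⟦X⟧) :
    formalTaylor (fun l => J l + J' l) y = formalTaylor J y + formalTaylor J' y := by
  simpa using formalTaylor_sum Finset.univ ![J, J'] y

variable {y : κ → A⟦X⟧} (hy : ∀ i, X ∣ y i)

include hy

theorem coeff_formalTaylor (J : Multiset κ → A⟦X⟧) {n N : ℕ} (h : n < N) :
    coeff n (formalTaylor J y) = coeff n (taylorPoly N J y) := by
  have := X_pow_dvd_iff.1 (X_pow_dvd_formalTaylor_sub_taylorPoly hy N J) n h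
  rwa [map_sub, sub_eq_zero] at this

theorem formalTaylor_mk (g : ℕ → Multiset κ → A) :
    formalTaylor (fun l => PowerSeries.mk fun n => g n l) y = PowerSeries.mk fun n =>
      ∑ ij ∈ Finset.HasAntidiagonal.antidiagonal n,
        coeff ij.2 (formalTaylor (fun l => PowerSeries.C (g ij.1 l)) y) := by
  ext n
  have truncate (ij : ℕ × ℕ) (h : ij ∈ Finset.HasAntidiagonal.antidiagonal n) :
      coeff ij.2 (formalTaylor (fun l => PowerSeries.C (g ij.1 l)) y) =
        coeff ij.2 (taylorPoly (n + 1) (fun l => PowerSeries.C (g ij.1 l)) y) :=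
    coeff_formalTaylor hy _
      (Nat.lt_succ_of_le (Finset.HasAntidiagonal.mem_antidiagonal.1 h ▸ Nat.le_add_left _ _))
  rw [formalTaylor, coeff_mk, coeff_mk, Finset.sum_congr rfl truncate]
  simp only [taylorPoly, taylorTerm_eq_sum, map_sum, LinearMap.map_smul_of_tower, coeff_C_mul]
  simp only [coeff_mul, coeff_mk]
  rw [Finset.sum_comm]
  refine Finset.sum_congr rfl fun m _ => ?_
  rw [← Finset.smul_sum, Finset.sum_comm]

theorem formalTaylor_of_affine {J : Multiset κ → A⟦X⟧} (hJ : ∀ i j l, J (i ::ₘ j ::ₘ l) = 0) :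
    formalTaylor J y = J 0 + ∑ i, y i * J {i} := by
  have vanish (m : ℕ) : taylorTerm y (m + 2) J = 0 := by
    simp only [taylorTerm_succ, hJ]
    simp [taylorTerm_eq_sum]
  refine eq_of_forall_X_pow_dvd_sub fun N => ?_
  have := (pow_dvd_pow (X : A⟦X⟧) (Nat.le_add_right N 2)).trans
    (X_pow_dvd_formalTaylor_sub_taylorPoly hy (N + 2) J)
  rw [taylorPoly, Finset.sum_range_succ', Finset.sum_range_succ',
    Finset.sum_eq_zero fun m _ => by rw [vanish, smul_zero]] at this
  simpa [taylorTerm, add_comm] using this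

end TaylorSums

section CriticalValue

variable {κ : Type*} [Fintype κ] {A : Type*} [CommRing A] [Algebra ℚ A]

/-- The gradient at `y` of the formal function with jets `J`. -/
def formalGrad (J : Multiset κ → A⟦X⟧) (y : κ → A⟦X⟧) (i : κ) : A⟦X⟧ :=
  formalTaylor (fun l => J (i ::ₘ l)) y

/-- The critical point equation `y = P ∇J(y)`. -/
def IsCriticalPoint (P : Matrix κ κ ℚ) (J : Multiset κ → A⟦X⟧) (y : κ → A⟦X⟧) : Prop :=
  ∀ i, y i = ∑ j, P i j • formalGrad J y j

/-- The value `J(y) - ½ ⟨∇J(y), P ∇J(y)⟩`. At a critical point `y` it is, for an invertible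
symmetric matrix `P`, the value of the function `J(y) - ½ ⟨y, P⁻¹ y⟩` which is critical at `y`. -/
def criticalValue (P : Matrix κ κ ℚ) (J : Multiset κ → A⟦X⟧) (y : κ → A⟦X⟧) : A⟦X⟧ :=
  formalTaylor J y - (2⁻¹ : ℚ) • ∑ i, ∑ j, P i j • (formalGrad J y i * formalGrad J y j)

variable {P : Matrix κ κ ℚ} {J : Multiset κ → A⟦X⟧} {y : κ → A⟦X⟧}

theorem existsUnique_isCriticalPoint (P : Matrix κ κ ℚ) (hJ : ∀ l, X ∣ J l) :
    ∃! y, IsCriticalPoint P J y := by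
  have contracting (n : ℕ) (y z : κ → A⟦X⟧) (h : ∀ i, X ^ n ∣ y i - z i) (i : κ) :
      X ^ (n + 1) ∣ ∑ j, P i j • formalGrad J y j - ∑ j, P i j • formalGrad J z j := by
    simp only [← Finset.sum_sub_distrib, ← smul_sub]
    exact Finset.dvd_sum fun j _ =>
      dvd_smul_of_dvd _ (X_pow_succ_dvd_formalTaylor_sub h fun l => hJ _)
  simpa only [IsCriticalPoint, funext_iff] using existsUnique_fixedPoint contracting

theorem IsCriticalPoint.X_dvd (h : IsCriticalPoint P J y) (hJ : ∀ l, X ∣ J l) (i : κ) :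
    X ∣ y i :=
  h i ▸ Finset.dvd_sum fun _ _ => dvd_smul_of_dvd _ (X_dvd_formalTaylor (fun _ => hJ _) y)

section Map

variable {B : Type*} [CommRing B] [Algebra ℚ B] {θ : A⟦X⟧ →ₐ[ℚ] B⟦X⟧}

theorem map_formalGrad (hθ : X ∣ θ X) (hy : ∀ i, X ∣ y i) (i : κ) :
    θ (formalGrad J y i) = formalGrad (fun l => θ (J l)) (fun i => θ (y i)) i :=
  map_formalTaylor hy hθ _

theorem IsCriticalPoint.map (h : IsCriticalPoint P J y) (hθ : X ∣ θ X) (hy : ∀ i, X ∣ y i) :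
    IsCriticalPoint P (fun l => θ (J l)) fun i => θ (y i) := by
  intro i
  simp only [← map_formalGrad hθ hy, ← map_smul, ← map_sum]
  exact congr_arg θ (h i)

theorem map_criticalValue (hθ : X ∣ θ X) (hy : ∀ i, X ∣ y i) :
    θ (criticalValue P J y) = criticalValue P (fun l => θ (J l)) fun i => θ (y i) := by
  simp only [criticalValue, map_sub, map_smul, map_sum, map_mul, map_formalTaylor hy hθ,
    map_formalGrad hθ hy]

end Map

/-- At a critical point only the explicit dependence on the jets contributes. -/
theorem derivation_criticalValue (hP : P.IsSymm) (h : IsCriticalPoint P J y)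
    (hJ : ∀ l, X ∣ J l) {D : Derivation ℚ A⟦X⟧ A⟦X⟧} (hD : X ∣ D X) :
    D (criticalValue P J y) = formalTaylor (fun l => D (J l)) y := by
  have symmetric : ∑ i, ∑ j, P i j • (formalGrad J y i * D (formalGrad J y j)) =
      ∑ i, ∑ j, P i j • (formalGrad J y j * D (formalGrad J y i)) := by
    rw [Finset.sum_comm]
    simp only [hP.apply]
  have quadratic : D (∑ i, ∑ j, P i j • (formalGrad J y i * formalGrad J y j)) =
      (2 : ℚ) • ∑ i, formalGrad J y i * D (y i) := by
    simp only [h _, map_sum, Derivation.map_smul, Derivation.leibniz, smul_eq_mul, smul_add,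
      Finset.sum_add_distrib, Finset.mul_sum, mul_smul_comm, ← symmetric, two_smul]
  rw [criticalValue, map_sub, derivation_formalTaylor (h.X_dvd hJ) hD, Derivation.map_smul,
    quadratic, smul_smul, inv_mul_cancel₀ two_ne_zero, one_smul]
  exact add_sub_cancel_right _ _

end CriticalValue

section ScaledJet

variable {κ A : Type*} [CommRing A]

/-- The jets of `X • J`, which are fixed by the Euler derivation. -/
def scaledJet (J : Multiset κ → A) (l : Multiset κ) : A⟦X⟧ :=
  X * PowerSeries.C (J l)

theorem X_dvd_scaledJet (J : Multiset κ → A) (l : Multiset κ) : X ∣ scaledJet J l :=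
  dvd_mul_right _ _

end ScaledJet

section HomogeneousRecursion

variable {κ : Type*} [Fintype κ] {A : Type*} [CommRing A] [Algebra ℚ A]

/-- The coefficientwise extension of a derivation to formal power series. -/
def coeffwise (D : Derivation ℚ A A) : Derivation ℚ A⟦X⟧ A⟦X⟧ :=
  Derivation.mk'
    { toFun := fun f => PowerSeries.mk fun n => D (coeff n f)
      map_add' := fun f g => by ext n; simp
      map_smul' := fun r f => by ext n; simp }
    fun f g => by
      ext n
      simp only [LinearMap.coe_mk, AddHom.coe_mk, coeff_mk, coeff_mul, map_sum, Derivation.leibniz,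
        smul_eq_mul, Finset.sum_add_distrib, map_add]
      congr 1
      rw [← Finset.Nat.sum_antidiagonal_swap]
      simp

theorem coeff_coeffwise (D : Derivation ℚ A A) (n : ℕ) (f : A⟦X⟧) :
    coeff n (coeffwise D f) = D (coeff n f) :=
  coeff_mk n fun m => D (coeff m f)

theorem coeffwise_X_mul_C (D : Derivation ℚ A A) (a : A) :
    coeffwise D (X * PowerSeries.C a) = X * PowerSeries.C (D a) := by
  ext n
  rw [coeff_coeffwise, coeff_mul_C, coeff_mul_C, coeff_X]
  split_ifs <;> simp

theorem X_dvd_coeffwise_X (D : Derivation ℚ A A) : X ∣ coeffwise D X := by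
  rw [X_dvd_iff, ← coeff_zero_eq_constantCoeff_apply, coeff_coeffwise, coeff_zero_X, map_zero]

/-- The Euler derivation `X d/dX`. -/
def euler (A : Type*) [CommRing A] [Algebra ℚ A] : Derivation ℚ A⟦X⟧ A⟦X⟧ :=
  (X : A⟦X⟧) • (d⁄dX A).restrictScalars ℚ

theorem coeff_euler (n : ℕ) (f : A⟦X⟧) : coeff n (euler A f) = (n : ℚ) • coeff n f := by
  rcases n with - | n
  · simp [euler]
  · simp [euler, coeff_succ_X_mul, coeff_derivative, Algebra.smul_def, mul_comm]

theorem euler_X_mul_C (a : A) : euler A (X * PowerSeries.C a) = X * PowerSeries.C a := by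
  ext n
  rw [coeff_euler, coeff_mul_C, coeff_X]
  split_ifs with h <;> simp [h]

theorem X_dvd_euler_X : X ∣ euler A X := by
  simp [euler]

variable {P : Matrix κ κ ℚ} {J : Multiset κ → A} {y : κ → A⟦X⟧}

theorem coeff_zero_criticalValue : coeff 0 (criticalValue P (scaledJet J) y) = 0 := by
  have value : X ∣ formalTaylor (scaledJet J) y := X_dvd_formalTaylor (X_dvd_scaledJet J) y
  have gradient (i : κ) : X ∣ formalGrad (scaledJet J) y i :=
    X_dvd_formalTaylor (fun _ => X_dvd_scaledJet J _) y
  rw [coeff_zero_eq_constantCoeff_apply, ← X_dvd_iff]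
  exact dvd_sub value (dvd_smul_of_dvd _ (Finset.dvd_sum fun i _ => Finset.dvd_sum fun j _ =>
    dvd_smul_of_dvd _ ((gradient i).mul_right _)))

variable (hy : IsCriticalPoint P (scaledJet J) y)

include hy

theorem coeff_one_criticalValue : coeff 1 (criticalValue P (scaledJet J) y) = J 0 := by
  have value : X ^ 2 ∣ formalTaylor (scaledJet J) y - scaledJet J 0 := by
    have := X_pow_succ_dvd_formalTaylor_sub (n := 1) (y := y) (z := 0)
      (by simpa using hy.X_dvd (X_dvd_scaledJet J)) (X_dvd_scaledJet J)
    rwa [formalTaylor_zero] at this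
  have gradient (i : κ) : X ∣ formalGrad (scaledJet J) y i :=
    X_dvd_formalTaylor (fun _ => X_dvd_scaledJet J _) y
  have quadratic : X ^ 2 ∣ (2⁻¹ : ℚ) •
      ∑ i, ∑ j, P i j • (formalGrad (scaledJet J) y i * formalGrad (scaledJet J) y j) :=
    dvd_smul_of_dvd _ (Finset.dvd_sum fun i _ => Finset.dvd_sum fun j _ =>
      dvd_smul_of_dvd _ (pow_two (X : A⟦X⟧) ▸ mul_dvd_mul (gradient i) (gradient j)))
  have := X_pow_dvd_iff.1 (dvd_sub value quadratic) 1 one_lt_two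
  rwa [sub_right_comm, map_sub, sub_eq_zero, scaledJet, coeff_mul_C, coeff_one_X, one_mul] at this

variable (hP : P.IsSymm) {D : κ → Derivation ℚ A A} (hD : ∀ i l, D i (J l) = J (i ::ₘ l))

include hP hD

theorem coeffwise_criticalValue (i : κ) :
    coeffwise (D i) (criticalValue P (scaledJet J) y) = formalGrad (scaledJet J) y i := by
  rw [derivation_criticalValue hP hy (X_dvd_scaledJet J) (X_dvd_coeffwise_X _)]
  simp only [scaledJet, coeffwise_X_mul_C, hD]
  rfl

/-- The Hamilton–Jacobi equation of the critical value as a function of the jets. -/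
theorem euler_criticalValue_sub :
    euler A (criticalValue P (scaledJet J) y) - criticalValue P (scaledJet J) y =
      (2⁻¹ : ℚ) • ∑ i, ∑ j, P i j • (coeffwise (D i) (criticalValue P (scaledJet J) y) *
        coeffwise (D j) (criticalValue P (scaledJet J) y)) := by
  simp only [coeffwise_criticalValue hy hP hD]
  rw [derivation_criticalValue hP hy (X_dvd_scaledJet J) X_dvd_euler_X, criticalValue]
  have : (fun l => euler A (scaledJet J l)) = scaledJet J := funext fun l => euler_X_mul_C (J l)
  rw [this, sub_sub_cancel]

theorem coeff_criticalValue_recursion (n : ℕ) :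
    (2 * (n - 1) : ℚ) • coeff n (criticalValue P (scaledJet J) y) =
      ∑ m ∈ Finset.HasAntidiagonal.antidiagonal n, ∑ i, ∑ j, P i j •
        (D i (coeff m.1 (criticalValue P (scaledJet J) y)) *
          D j (coeff m.2 (criticalValue P (scaledJet J) y))) := by
  set W := criticalValue P (scaledJet J) y
  calc (2 * (n - 1) : ℚ) • coeff n W = (2 : ℚ) • coeff n (euler A W - W) := by
        rw [map_sub, coeff_euler]
        module
    _ = coeff n (∑ i, ∑ j, P i j • (coeffwise (D i) W * coeffwise (D j) W)) := by
        rw [euler_criticalValue_sub hy hP hD, LinearMap.map_smul_of_tower, smul_smul,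
          mul_inv_cancel₀ two_ne_zero, one_smul]
    _ = _ := by
        simp only [map_sum, LinearMap.map_smul_of_tower, coeff_mul, coeff_coeffwise,
          Finset.smul_sum, Finset.sum_comm (s := Finset.HasAntidiagonal.antidiagonal n)]

end HomogeneousRecursion

section TreeOn

variable {V W : Type*} {G H H₁ H₂ : SimpleGraph V} {A A₁ A₂ B : Finset V} {a b v w : V}

theorem reachable_map_of_adj {K : SimpleGraph W} (f : V → W)
    (hf : ∀ u v, G.Adj u v → K.Reachable (f u) (f v)) (h : G.Reachable v w) :
    K.Reachable (f v) (f w) := by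
  rw [SimpleGraph.reachable_iff_reflTransGen] at h
  induction h with
  | refl => exact SimpleGraph.Reachable.rfl
  | tail _ huv ih => exact ih.trans (hf _ _ huv)

theorem mem_of_reachable_of_adj {S : Set V} (hS : ∀ u v, G.Adj u v → u ∈ S → v ∈ S)
    (h : G.Reachable v w) (hv : v ∈ S) : w ∈ S := by
  rw [SimpleGraph.reachable_iff_reflTransGen] at h
  induction h with
  | refl => exact hv
  | tail _ huv ih => exact hS _ _ huv ih

theorem deleteEdges_adj_of_ne (h : G.Adj v w) (hne : s(v, w) ≠ s(a, b)) :
    (G.deleteEdges {s(a, b)}).Adj v w :=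
  SimpleGraph.deleteEdges_adj.2 ⟨h, hne⟩

/-- `G` is a tree with vertex set `A`, the vertices of `V` outside `A` being isolated in `G`. -/
structure IsTreeOn (G : SimpleGraph V) (A : Finset V) : Prop where
  nonempty : A.Nonempty
  left_mem : ∀ ⦃v w⦄, G.Adj v w → v ∈ A
  reachable : ∀ ⦃v⦄, v ∈ A → ∀ ⦃w⦄, w ∈ A → G.Reachable v w
  isAcyclic : G.IsAcyclic

theorem IsTreeOn.right_mem (h : IsTreeOn G A) (hvw : G.Adj v w) : w ∈ A :=
  h.left_mem hvw.symm

theorem isTreeOn_univ_iff [Fintype V] : IsTreeOn G Finset.univ ↔ G.IsTree := by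
  rw [SimpleGraph.isTree_iff, SimpleGraph.connected_iff]
  constructor
  · intro h
    exact ⟨⟨fun v w => h.reachable (Finset.mem_univ v) (Finset.mem_univ w),
      h.nonempty.elim fun v _ => ⟨v⟩⟩, h.isAcyclic⟩
  · rintro ⟨⟨hconn, hne⟩, hacyc⟩
    exact ⟨Finset.univ_nonempty, fun v _ _ => Finset.mem_univ v, fun v _ w _ => hconn v w, hacyc⟩

theorem isTreeOn_singleton_iff : IsTreeOn G {v} ↔ G = ⊥ := by
  constructor
  · intro h
    ext u w
    simp only [SimpleGraph.bot_adj, iff_false]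
    intro huw
    exact huw.ne ((Finset.mem_singleton.1 (h.left_mem huw)).trans
      (Finset.mem_singleton.1 (h.right_mem huw)).symm)
  · rintro rfl
    refine ⟨Finset.singleton_nonempty v, by simp, fun u hu w hw => ?_, SimpleGraph.isAcyclic_bot⟩
    rw [Finset.mem_singleton.1 hu, Finset.mem_singleton.1 hw]

theorem IsTreeOn.isTree_induce (h : IsTreeOn G A) : (G.induce (A : Set V)).IsTree := by
  classical
  obtain ⟨r, hr⟩ := h.nonempty
  -- `G` retracts onto `A` by sending the isolated vertices outside `A` to `r`.
  let retract : V → (A : Set V) := fun u => if hu : u ∈ A then ⟨u, hu⟩ else ⟨r, hr⟩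
  have retract_eq (v : (A : Set V)) : retract v = v := dif_pos v.2
  have retract_adj (u v : V) (huv : G.Adj u v) :
      (G.induce (A : Set V)).Reachable (retract u) (retract v) := by
    simp only [retract, dif_pos (h.left_mem huv), dif_pos (h.right_mem huv)]
    exact SimpleGraph.Adj.reachable huv
  refine ⟨SimpleGraph.connected_iff _ |>.2 ⟨fun v w => ?_, ⟨r, hr⟩⟩, h.isAcyclic.induce _⟩
  rw [← retract_eq v, ← retract_eq w]
  exact reachable_map_of_adj retract retract_adj (h.reachable v.2 w.2)

theorem IsTreeOn.card_edgeFinset [Fintype V] [DecidableRel G.Adj] (h : IsTreeOn G A) :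
    G.edgeFinset.card + 1 = A.card := by
  classical
  have hsupp : G.support ⊆ (A : Set V) := fun v ⟨w, hvw⟩ => h.left_mem hvw
  have hcard := h.isTree_induce.card_edgeFinset
  rw [← Nat.card_eq_fintype_card, Nat.card_coe_set_eq, Set.ncard_coe_finset] at hcard
  rw [← SimpleGraph.card_edgeFinset_induce_of_support_subset hsupp, ← hcard]
  congr!

/-- The graph on `V` obtained from `G` by keeping only the edges inside `B`. -/
def restrict (G : SimpleGraph V) (B : Finset V) : SimpleGraph V :=
  (G.induce (B : Set V)).spanningCoe

theorem restrict_adj : (restrict G B).Adj v w ↔ G.Adj v w ∧ v ∈ B ∧ w ∈ B := by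
  simp [restrict, and_left_comm, and_assoc, and_comm]

theorem restrict_le (G : SimpleGraph V) (B : Finset V) : restrict G B ≤ G :=
  G.spanningCoe_induce_le _

/-- `s(a, b)` is the only edge of `G` between `B` and its complement, and `a ∈ B`. -/
structure IsCut (G : SimpleGraph V) (B : Finset V) (a b : V) : Prop where
  adj : G.Adj a b
  left_mem : a ∈ B
  right_notMem : b ∉ B
  eq_of_adj : ∀ ⦃v w⦄, G.Adj v w → v ∈ B → w ∉ B → v = a ∧ w = b

theorem IsTreeOn.restrict (h : IsTreeOn G A) (hBA : B ⊆ A) (hB : IsCut G B a b) :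
    IsTreeOn (restrict G B) B where
  nonempty := ⟨a, hB.left_mem⟩
  left_mem _ _ hvw := (restrict_adj.1 hvw).2.1
  isAcyclic := h.isAcyclic.anti (restrict_le G B)
  reachable v hv w hw := by
    classical
    -- `G` retracts onto `B` by collapsing the other side of the cut to `a`.
    let retract : V → V := fun u => if u ∈ B then u else a
    have retract_adj (u x : V) (hux : G.Adj u x) :
        (SGA.restrict G B).Reachable (retract u) (retract x) := by
      by_cases hu : u ∈ B <;> by_cases hx : x ∈ B <;> simp only [retract, hu, hx, if_true, if_false]
      · exact (restrict_adj.2 ⟨hux, hu, hx⟩).reachable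
      · rw [(hB.eq_of_adj hux hu hx).1]
      · rw [(hB.eq_of_adj hux.symm hx hu).1]
      · exact SimpleGraph.Reachable.rfl
    have hr := reachable_map_of_adj retract retract_adj (h.reachable (hBA hv) (hBA hw))
    simpa only [retract, if_pos hv, if_pos hw] using hr

theorem IsTreeOn.existsUnique_isCut (h : IsTreeOn G A) (hab : G.Adj a b) :
    ∃! B, B ⊆ A ∧ IsCut G B a b := by
  classical
  have hbridge : ¬(G.deleteEdges {s(a, b)}).Reachable a b :=
    SimpleGraph.isBridge_iff.1 (SimpleGraph.isAcyclic_iff_forall_adj_isBridge.1 h.isAcyclic hab)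
  refine ⟨A.filter ((G.deleteEdges {s(a, b)}).Reachable a),
    ⟨Finset.filter_subset _ _, hab, by simp [h.left_mem hab], by simp [hbridge], ?_⟩, ?_⟩
  · intro v w hvw hv hw
    have hne : s(v, w) = s(a, b) := by
      by_contra hne
      exact hw (Finset.mem_filter.2 ⟨h.right_mem hvw,
        (Finset.mem_filter.1 hv).2.trans (deleteEdges_adj_of_ne hvw hne).reachable⟩)
    refine (Sym2.eq_iff.1 hne).resolve_right ?_
    rintro ⟨rfl, rfl⟩
    exact hbridge (Finset.mem_filter.1 hv).2
  · rintro B ⟨hBA, hB⟩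
    have mem_iff (u v : V) (huv : (G.deleteEdges {s(a, b)}).Adj u v) : u ∈ B → v ∈ B := by
      obtain ⟨huv, hne⟩ := SimpleGraph.deleteEdges_adj.1 huv
      intro hu
      by_contra hv
      obtain ⟨rfl, rfl⟩ := hB.eq_of_adj huv hu hv
      exact hne rfl
    ext v
    refine ⟨fun hv => Finset.mem_filter.2 ⟨hBA hv, ?_⟩, fun hv =>
      mem_of_reachable_of_adj (S := B) mem_iff (Finset.mem_filter.1 hv).2 hB.left_mem⟩
    refine ((h.restrict hBA hB).reachable hB.left_mem hv).mono fun u x hux => ?_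
    obtain ⟨hux, hu, hx⟩ := restrict_adj.1 hux
    refine deleteEdges_adj_of_ne hux fun he => ?_
    rcases Sym2.eq_iff.1 he with ⟨rfl, rfl⟩ | ⟨rfl, rfl⟩
    exacts [hB.right_notMem hx, hB.right_notMem hu]

theorem not_reachable_deleteEdges_sup (h₁ : H₁.IsAcyclic) (hd : ∀ u v w, H₁.Adj u v → ¬H₂.Adj u w)
    (hvw : H₁.Adj v w) : ¬((H₁ ⊔ H₂).deleteEdges {s(v, w)}).Reachable v w := by
  classical
  intro hr
  -- Collapse the support of `H₂` to `v`.
  let retract : V → V := fun u => if u ∈ H₁.support then u else v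
  have retract_adj (u x : V) (hux : ((H₁ ⊔ H₂).deleteEdges {s(v, w)}).Adj u x) :
      (H₁.deleteEdges {s(v, w)}).Reachable (retract u) (retract x) := by
    obtain ⟨hux | hux, hne⟩ := SimpleGraph.deleteEdges_adj.1 hux
    · simp only [retract, if_pos (show u ∈ H₁.support from ⟨x, hux⟩),
        if_pos (show x ∈ H₁.support from ⟨u, hux.symm⟩)]
      exact (deleteEdges_adj_of_ne hux hne).reachable
    · have hu : u ∉ H₁.support := fun ⟨y, hy⟩ => hd u y x hy hux
      have hx : x ∉ H₁.support := fun ⟨y, hy⟩ => hd x y u hy hux.symm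
      simp only [retract, if_neg hu, if_neg hx]
      exact SimpleGraph.Reachable.rfl
  have hr' := reachable_map_of_adj retract retract_adj hr
  simp only [retract, if_pos (show v ∈ H₁.support from ⟨w, hvw⟩),
    if_pos (show w ∈ H₁.support from ⟨v, hvw.symm⟩)] at hr'
  exact SimpleGraph.isBridge_iff.1
    (SimpleGraph.isAcyclic_iff_forall_adj_isBridge.1 h₁ hvw) hr'

theorem isAcyclic_sup (h₁ : H₁.IsAcyclic) (h₂ : H₂.IsAcyclic)
    (hd : ∀ u v w, H₁.Adj u v → ¬H₂.Adj u w) : (H₁ ⊔ H₂).IsAcyclic := by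
  rw [SimpleGraph.isAcyclic_iff_forall_adj_isBridge]
  intro v w hvw
  rw [SimpleGraph.isBridge_iff]
  rcases hvw with hvw | hvw
  · exact not_reachable_deleteEdges_sup h₁ hd hvw
  · rw [sup_comm]
    exact not_reachable_deleteEdges_sup h₂ (fun u v w h h' => hd u w v h' h) hvw

/-- The graph obtained from `H₁` and `H₂` by adding the edge `s(a, b)`. -/
def join (H₁ H₂ : SimpleGraph V) (a b : V) : SimpleGraph V :=
  H₁ ⊔ H₂ ⊔ SimpleGraph.edge a b

theorem join_comm (H₁ H₂ : SimpleGraph V) (a b : V) : join H₁ H₂ a b = join H₂ H₁ b a := by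
  rw [join, join, sup_comm H₁, SimpleGraph.edge_comm]

theorem adj_join (hab : a ≠ b) :
    (join H₁ H₂ a b).Adj v w ↔ H₁.Adj v w ∨ H₂.Adj v w ∨ s(v, w) = s(a, b) := by
  simp only [join, SimpleGraph.sup_adj, SimpleGraph.adj_edge, or_assoc]
  refine or_congr_right (or_congr_right ⟨fun h => h.1.symm, fun h => ⟨h.symm, ?_⟩⟩)
  rcases Sym2.eq_iff.1 h with ⟨rfl, rfl⟩ | ⟨rfl, rfl⟩
  exacts [hab, hab.symm]

section Join

variable (h₁ : IsTreeOn H₁ A₁) (h₂ : IsTreeOn H₂ A₂) (hd : Disjoint A₁ A₂) (ha : a ∈ A₁)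
  (hb : b ∈ A₂)

include h₁ h₂ hd ha hb

theorem isCut_join : IsCut (join H₁ H₂ a b) A₁ a b where
  adj := (adj_join (hd.forall_ne_finset ha hb)).2 (Or.inr (Or.inr rfl))
  left_mem := ha
  right_notMem := Finset.disjoint_right.1 hd hb
  eq_of_adj v w hvw hv hw := by
    rcases (adj_join (hd.forall_ne_finset ha hb)).1 hvw with h | h | h
    · exact absurd (h₁.right_mem h) hw
    · exact absurd (h₂.left_mem h) (Finset.disjoint_left.1 hd hv)
    · refine (Sym2.eq_iff.1 h).resolve_right ?_
      rintro ⟨rfl, rfl⟩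
      exact Finset.disjoint_left.1 hd hv hb

theorem restrict_join_left : restrict (join H₁ H₂ a b) A₁ = H₁ := by
  have hcut := isCut_join h₁ h₂ hd ha hb
  ext v w
  rw [restrict_adj, adj_join hcut.adj.ne]
  constructor
  · rintro ⟨h | h | h, hv, hw⟩
    · exact h
    · exact absurd (h₂.left_mem h) (Finset.disjoint_left.1 hd hv)
    · rcases Sym2.eq_iff.1 h with ⟨rfl, rfl⟩ | ⟨rfl, rfl⟩
      exacts [absurd hw hcut.right_notMem, absurd hv hcut.right_notMem]
  · exact fun h => ⟨Or.inl h, h₁.left_mem h, h₁.right_mem h⟩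

theorem restrict_join_right : restrict (join H₁ H₂ a b) A₂ = H₂ := by
  rw [join_comm, restrict_join_left h₂ h₁ hd.symm hb ha]

theorem IsTreeOn.join [DecidableEq V] : IsTreeOn (join H₁ H₂ a b) (A₁ ∪ A₂) where
  nonempty := ⟨a, Finset.mem_union_left _ ha⟩
  left_mem v w hvw := by
    rcases (adj_join (hd.forall_ne_finset ha hb)).1 hvw with h | h | h
    · exact Finset.mem_union_left _ (h₁.left_mem h)
    · exact Finset.mem_union_right _ (h₂.left_mem h)
    · rcases Sym2.eq_iff.1 h with ⟨rfl, -⟩ | ⟨rfl, -⟩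
      exacts [Finset.mem_union_left _ ha, Finset.mem_union_right _ hb]
  reachable := by
    have reachable_left : ∀ v ∈ A₁ ∪ A₂, (SGA.join H₁ H₂ a b).Reachable a v := by
      intro v hv
      rcases Finset.mem_union.1 hv with hv | hv
      · exact (h₁.reachable ha hv).mono (le_sup_left.trans le_sup_left)
      · exact (isCut_join h₁ h₂ hd ha hb).adj.reachable.trans
          ((h₂.reachable hb hv).mono (le_sup_right.trans le_sup_left))
    exact fun v hv w hw => (reachable_left v hv).symm.trans (reachable_left w hw)
  isAcyclic := by
    have hdisj (u v w : V) (huv : H₁.Adj u v) : ¬H₂.Adj u w := fun huw =>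
      Finset.disjoint_left.1 hd (h₁.left_mem huv) (h₂.left_mem huw)
    refine SimpleGraph.IsAcyclic.sup_edge_of_not_reachable (fun hr => ?_)
      (isAcyclic_sup h₁.isAcyclic h₂.isAcyclic hdisj)
    refine Finset.disjoint_right.1 hd hb (mem_of_reachable_of_adj (S := A₁) ?_ hr ha)
    rintro u v (huv | huv) hu
    exacts [h₁.right_mem huv, absurd (h₂.left_mem huv) (Finset.disjoint_left.1 hd hu)]

end Join

variable [DecidableEq V]

theorem IsCut.sdiff (hB : IsCut G B a b) (h : IsTreeOn G A) : IsCut G (A \ B) b a where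
  adj := hB.adj.symm
  left_mem := Finset.mem_sdiff.2 ⟨h.right_mem hB.adj, hB.right_notMem⟩
  right_notMem ha := (Finset.mem_sdiff.1 ha).2 hB.left_mem
  eq_of_adj v w hvw hv hw := by
    have hw : w ∈ B := by
      by_contra hwB
      exact hw (Finset.mem_sdiff.2 ⟨h.right_mem hvw, hwB⟩)
    exact (hB.eq_of_adj hvw.symm hw (Finset.mem_sdiff.1 hv).2).symm

theorem join_restrict (h : IsTreeOn G A) (hB : IsCut G B a b) :
    join (restrict G B) (restrict G (A \ B)) a b = G := by
  ext v w
  rw [adj_join hB.adj.ne, restrict_adj, restrict_adj, Finset.mem_sdiff, Finset.mem_sdiff]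
  constructor
  · rintro (h | h | h)
    · exact h.1
    · exact h.1
    · rcases Sym2.eq_iff.1 h with ⟨rfl, rfl⟩ | ⟨rfl, rfl⟩
      exacts [hB.adj, hB.adj.symm]
  · intro hvw
    by_cases hv : v ∈ B <;> by_cases hw : w ∈ B
    · exact Or.inl ⟨hvw, hv, hw⟩
    · obtain ⟨rfl, rfl⟩ := hB.eq_of_adj hvw hv hw
      exact Or.inr (Or.inr rfl)
    · obtain ⟨rfl, rfl⟩ := hB.eq_of_adj hvw.symm hw hv
      exact Or.inr (Or.inr Sym2.eq_swap)
    · exact Or.inr (Or.inl ⟨hvw, ⟨h.left_mem hvw, hv⟩, h.right_mem hvw, hw⟩)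

end TreeOn

section WeightedTrees

variable {V : Type*} {R : Type*} [CommSemiring R] (w : Sym2 V → R)

/-- The product of the edge weights of a graph. -/
def edgeWeight (G : SimpleGraph V) : R :=
  ∏ᶠ e ∈ G.edgeSet, w e

theorem edgeWeight_join [Finite V] {H₁ H₂ : SimpleGraph V} {A₁ A₂ : Finset V} {a b : V}
    (h₁ : IsTreeOn H₁ A₁) (h₂ : IsTreeOn H₂ A₂) (hd : Disjoint A₁ A₂) (ha : a ∈ A₁)
    (hb : b ∈ A₂) :
    edgeWeight w (join H₁ H₂ a b) = w s(a, b) * (edgeWeight w H₁ * edgeWeight w H₂) := by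
  have hsup : Disjoint H₁.edgeSet H₂.edgeSet := by
    rw [SimpleGraph.disjoint_edgeSet, disjoint_iff]
    ext u v
    simp only [SimpleGraph.inf_adj, SimpleGraph.bot_adj, iff_false, not_and]
    exact fun h h' => Finset.disjoint_left.1 hd (h₁.left_mem h) (h₂.left_mem h')
  have hedge : Disjoint (H₁ ⊔ H₂).edgeSet {s(a, b)} := by
    rw [Set.disjoint_singleton_right, SimpleGraph.mem_edgeSet]
    rintro (h | h)
    exacts [Finset.disjoint_left.1 hd (h₁.right_mem h) hb,
      Finset.disjoint_left.1 hd ha (h₂.left_mem h)]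
  rw [edgeWeight, join, SimpleGraph.edgeSet_sup,
    SimpleGraph.edgeSet_edge_of_ne (hd.forall_ne_finset ha hb),
    finprod_mem_union hedge (Set.toFinite _) (Set.toFinite _), finprod_mem_singleton,
    SimpleGraph.edgeSet_sup, finprod_mem_union hsup (Set.toFinite _) (Set.toFinite _), mul_comm,
    edgeWeight, edgeWeight]

variable [Fintype V]

open Classical in
/-- The trees with vertex set `A`. -/
def treesOn (A : Finset V) : Finset (SimpleGraph V) :=
  Finset.univ.filter (IsTreeOn · A)

theorem mem_treesOn {G : SimpleGraph V} {A : Finset V} : G ∈ treesOn A ↔ IsTreeOn G A := by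
  simp [treesOn]

/-- The weighted count of the trees with vertex set `A`. -/
def treeSum (A : Finset V) : R :=
  ∑ G ∈ treesOn A, edgeWeight w G

theorem treeSum_singleton (v : V) : treeSum w {v} = 1 := by
  have htrees : treesOn {v} = {(⊥ : SimpleGraph V)} := by
    ext G
    rw [mem_treesOn, isTreeOn_singleton_iff, Finset.mem_singleton]
  simp [treeSum, htrees, edgeWeight]

theorem treeSum_empty : treeSum w (∅ : Finset V) = 0 :=
  Finset.sum_eq_zero fun G hG => absurd (mem_treesOn.1 hG).nonempty (by simp)

open Classical in
theorem sum_edgeWeight_isCut [DecidableEq V] {A B : Finset V} {a b : V} (hBA : B ⊆ A) (ha : a ∈ B)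
    (hb : b ∈ A \ B) :
    ∑ G ∈ treesOn A with IsCut G B a b, edgeWeight w G =
      w s(a, b) * (treeSum w B * treeSum w (A \ B)) := by
  have hd : Disjoint B (A \ B) := Finset.disjoint_sdiff
  rw [treeSum, treeSum, Finset.sum_mul_sum, ← Finset.sum_product', Finset.mul_sum]
  refine Finset.sum_bij' (fun G _ => (restrict G B, restrict G (A \ B)))
    (fun p _ => join p.1 p.2 a b) (fun G hG => ?_) (fun p hp => ?_) (fun G hG => ?_)
    (fun p hp => ?_) fun G hG => ?_
  · obtain ⟨hG, hB⟩ := Finset.mem_filter.1 hG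
    rw [mem_treesOn] at hG
    exact Finset.mem_product.2 ⟨mem_treesOn.2 (hG.restrict hBA hB),
      mem_treesOn.2 (hG.restrict Finset.sdiff_subset (hB.sdiff hG))⟩
  · simp only [Finset.mem_product, mem_treesOn] at hp
    refine Finset.mem_filter.2 ⟨mem_treesOn.2 ?_, isCut_join hp.1 hp.2 hd ha hb⟩
    simpa only [Finset.union_sdiff_of_subset hBA] using hp.1.join hp.2 hd ha hb
  · obtain ⟨hG, hB⟩ := Finset.mem_filter.1 hG
    exact join_restrict (mem_treesOn.1 hG) hB
  · simp only [Finset.mem_product, mem_treesOn] at hp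
    exact Prod.ext (restrict_join_left hp.1 hp.2 hd ha hb)
      (restrict_join_right hp.1 hp.2 hd ha hb)
  · obtain ⟨hG, hB⟩ := Finset.mem_filter.1 hG
    rw [mem_treesOn] at hG
    rw [← edgeWeight_join w (hG.restrict hBA hB)
      (hG.restrict Finset.sdiff_subset (hB.sdiff hG)) hd ha hb, join_restrict hG hB]

open Classical in
omit [Fintype V] in
theorem IsTreeOn.sum_isCut [Finite V] [DecidableEq V] {G : SimpleGraph V} {A : Finset V}
    (h : IsTreeOn G A) :
    ∑ B ∈ A.powerset, ∑ a ∈ B, ∑ b ∈ A \ B, (if IsCut G B a b then 1 else 0) =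
      2 * (A.card - 1) := by
  have := Fintype.ofFinite V
  have sum_cuts (a b : V) : ∑ B ∈ A.powerset, (if IsCut G B a b then 1 else 0) =
      if G.Adj a b then 1 else 0 := by
    rw [← Finset.card_filter]
    split_ifs with hab
    · obtain ⟨B, hB, hunique⟩ := h.existsUnique_isCut hab
      refine Finset.card_eq_one.2 ⟨B, ?_⟩
      ext B'
      simp only [Finset.mem_filter, Finset.mem_powerset, Finset.mem_singleton]
      exact ⟨hunique B', by rintro rfl; exact hB⟩
    · exact Finset.card_eq_zero.2 (Finset.filter_eq_empty_iff.2 fun B _ hB => hab hB.adj)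
  calc ∑ B ∈ A.powerset, ∑ a ∈ B, ∑ b ∈ A \ B, (if IsCut G B a b then 1 else 0)
      = ∑ B ∈ A.powerset, ∑ a, ∑ b, (if IsCut G B a b then 1 else 0) := by
        refine Finset.sum_congr rfl fun B _ => ?_
        rw [← Finset.sum_subset (Finset.subset_univ B) fun a _ ha =>
          Finset.sum_eq_zero fun b _ => if_neg fun hB => ha hB.left_mem]
        refine Finset.sum_congr rfl fun a _ => ?_
        exact Finset.sum_subset (Finset.subset_univ _) fun b _ hb => if_neg fun hB =>
          hb (hB.sdiff h).left_mem
    _ = ∑ a, ∑ b, ∑ B ∈ A.powerset, (if IsCut G B a b then 1 else 0) := by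
        rw [Finset.sum_comm]
        exact Finset.sum_congr rfl fun a _ => Finset.sum_comm
    _ = ∑ a, G.degree a := by
        refine Finset.sum_congr rfl fun a _ => ?_
        rw [← SimpleGraph.card_neighborFinset_eq_degree, SimpleGraph.neighborFinset_eq_filter,
          Finset.card_filter]
        exact Finset.sum_congr rfl fun b _ => sum_cuts a b
    _ = 2 * (A.card - 1) := by
        rw [SimpleGraph.sum_degrees_eq_twice_card_edges, ← h.card_edgeFinset, Nat.add_sub_cancel]

theorem treeSum_recursion [DecidableEq V] (A : Finset V) :
    2 * ((A.card - 1 : ℕ) : R) * treeSum w A =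
      ∑ B ∈ A.powerset, ∑ a ∈ B, ∑ b ∈ A \ B,
        w s(a, b) * (treeSum w B * treeSum w (A \ B)) := by
  classical
  have expand (G : SimpleGraph V) (hG : G ∈ treesOn A) :
      2 * ((A.card - 1 : ℕ) : R) * edgeWeight w G = ∑ B ∈ A.powerset, ∑ a ∈ B, ∑ b ∈ A \ B,
        if IsCut G B a b then edgeWeight w G else 0 := by
    have hcuts := congrArg (Nat.cast : ℕ → R) (mem_treesOn.1 hG).sum_isCut
    push_cast at hcuts
    rw [← hcuts]
    simp only [Finset.sum_mul, ite_mul, one_mul, zero_mul]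
  rw [treeSum, Finset.mul_sum, Finset.sum_congr rfl expand, Finset.sum_comm]
  refine Finset.sum_congr rfl fun B hB => ?_
  rw [Finset.sum_comm]
  refine Finset.sum_congr rfl fun a ha => ?_
  rw [Finset.sum_comm]
  refine Finset.sum_congr rfl fun b hb => ?_
  rw [← Finset.sum_filter, sum_edgeWeight_isCut w (Finset.mem_powerset.1 hB) ha hb]

end WeightedTrees

section Contraction

variable {V κ : Type*}

/-- The polynomials in the half-edges at the vertices in `B`. -/
def halfEdgesAt (κ : Type*) (B : Finset V) : Subalgebra ℚ (MvPolynomial (V × κ) ℚ) :=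
  MvPolynomial.supported ℚ {h | h.1 ∈ B}

theorem X_mem_halfEdgesAt {B : Finset V} {v : V} (hv : v ∈ B) (i : κ) :
    (MvPolynomial.X (v, i) : MvPolynomial (V × κ) ℚ) ∈ halfEdgesAt κ B :=
  MvPolynomial.X_mem_supported.2 hv

variable [DecidableEq V]

/-- The labels `i` of the factors `X (v, i)` of a monomial, each such factor being thought of as a
half-edge with label `i` attached to the vertex `v`. -/
def labelsAt (v : V) : (V × κ →₀ ℕ) →+ Multiset κ where
  toFun s := ((Finsupp.toMultiset s).filter fun h => h.1 = v).map Prod.snd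
  map_zero' := by simp
  map_add' s t := by simp

theorem mem_labelsAt {s : V × κ →₀ ℕ} {v : V} {i : κ} :
    i ∈ labelsAt v s ↔ (v, i) ∈ s.support := by
  simp [labelsAt]

theorem labelsAt_single (a v : V) (i : κ) :
    labelsAt v (Finsupp.single (a, i) 1) = if a = v then {i} else 0 := by
  change ((Finsupp.toMultiset _).filter _).map _ = _
  rw [Finsupp.toMultiset_single, one_smul, Multiset.filter_singleton]
  split_ifs <;> simp

theorem labelsAt_eq_zero {B : Finset V} {p : MvPolynomial (V × κ) ℚ} (hp : p ∈ halfEdgesAt κ B)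
    {s : V × κ →₀ ℕ} (hs : s ∈ p.support) {v : V} (hv : v ∉ B) : labelsAt v s = 0 := by
  refine Multiset.eq_zero_of_forall_notMem fun i hi => ?_
  exact hv (MvPolynomial.mem_supported.1 hp
    ((MvPolynomial.mem_vars_iff_mem_support (v, i)).2 ⟨s, hs, mem_labelsAt.1 hi⟩))

variable {A : Type*} [CommRing A] [Algebra ℚ A] (J : V → Multiset κ → A)

/-- The linear extension of the map which sends a monomial to the product over the vertices in `B`
of the jets of order given by the half-edges. -/
def contract (B : Finset V) : MvPolynomial (V × κ) ℚ →ₗ[ℚ] A :=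
  (MvPolynomial.basisMonomials (V × κ) ℚ).constr ℚ fun s => ∏ v ∈ B, J v (labelsAt v s)

theorem contract_monomial (B : Finset V) (s : V × κ →₀ ℕ) (r : ℚ) :
    contract J B (MvPolynomial.monomial s r) = r • ∏ v ∈ B, J v (labelsAt v s) := by
  have hs : MvPolynomial.monomial s r = r • MvPolynomial.basisMonomials (V × κ) ℚ s := by
    simp [MvPolynomial.smul_monomial]
  rw [hs, map_smul, contract, Module.Basis.constr_basis]

theorem contract_one (B : Finset V) : contract J B 1 = ∏ v ∈ B, J v 0 := by
  rw [← map_one MvPolynomial.C, ← MvPolynomial.monomial_zero', contract_monomial]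
  simp

variable {J}

theorem contract_mul {B C : Finset V} (hBC : Disjoint B C) {p q : MvPolynomial (V × κ) ℚ}
    (hp : p ∈ halfEdgesAt κ B) (hq : q ∈ halfEdgesAt κ C) :
    contract J (B ∪ C) (p * q) = contract J B p * contract J C q := by
  conv_lhs => rw [p.as_sum, q.as_sum]
  conv_rhs => rw [p.as_sum, q.as_sum]
  simp only [map_sum, Finset.sum_mul_sum, MvPolynomial.monomial_mul, contract_monomial]
  refine Finset.sum_congr rfl fun s hs => Finset.sum_congr rfl fun t ht => ?_
  have prod_left : ∏ v ∈ B, J v (labelsAt v (s + t)) = ∏ v ∈ B, J v (labelsAt v s) :=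
    Finset.prod_congr rfl fun v hv => by
      rw [map_add, labelsAt_eq_zero hq ht (Finset.disjoint_left.1 hBC hv), add_zero]
  have prod_right : ∏ v ∈ C, J v (labelsAt v (s + t)) = ∏ v ∈ C, J v (labelsAt v t) :=
    Finset.prod_congr rfl fun v hv => by
      rw [map_add, labelsAt_eq_zero hp hs (Finset.disjoint_right.1 hBC hv), zero_add]
  rw [Finset.prod_union hBC, prod_left, prod_right, smul_mul_smul_comm]

theorem derivation_prod {ι : Type*} [DecidableEq ι] (D : Derivation ℚ A A) (s : Finset ι)
    (f : ι → A) : D (∏ v ∈ s, f v) = ∑ a ∈ s, ∏ v ∈ s, Function.update f a (D (f a)) v := by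
  induction s using Finset.induction_on with
  | empty => simp
  | insert x s hx ih =>
    rw [Finset.prod_insert hx, Derivation.leibniz, ih, Finset.sum_insert hx, Finset.prod_insert hx,
      Function.update_self, smul_eq_mul, smul_eq_mul, add_comm, Finset.mul_sum,
      Finset.prod_update_of_notMem hx, mul_comm]
    refine congrArg _ (Finset.sum_congr rfl fun a ha => ?_)
    rw [Finset.prod_insert hx, Function.update_of_ne (ne_of_mem_of_not_mem ha hx).symm]

theorem derivation_contract {D : Derivation ℚ A A} {i : κ} (hD : ∀ v l, D (J v l) = J v (i ::ₘ l))
    (B : Finset V) (p : MvPolynomial (V × κ) ℚ) :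
    D (contract J B p) = contract J B ((∑ a ∈ B, MvPolynomial.X (a, i)) * p) := by
  induction p using MvPolynomial.induction_on' with
  | add p q hp hq => rw [map_add, map_add, hp, hq, mul_add, map_add]
  | monomial s r =>
    simp only [Finset.sum_mul, map_sum, MvPolynomial.X, MvPolynomial.monomial_mul, one_mul,
      contract_monomial]
    rw [Derivation.map_smul, derivation_prod, Finset.smul_sum]
    simp only [hD]
    refine Finset.sum_congr rfl fun a _ => congrArg _ (Finset.prod_congr rfl fun v _ => ?_)
    rw [map_add, labelsAt_single]
    by_cases hv : a = v
    · rw [hv, Function.update_self, if_pos rfl, Multiset.singleton_add]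
    · rw [Function.update_of_ne (Ne.symm hv), if_neg hv, zero_add]

end Contraction

theorem sum_powerset_factorial_smul {V M : Type*} [AddCommGroup M] [Module ℚ M] (B : Finset V)
    (g : ℕ → ℕ → M) :
    ∑ C ∈ B.powerset, (C.card ! * (B.card - C.card)! : ℚ) • g C.card (B.card - C.card) =
      (B.card ! : ℚ) • ∑ m ∈ Finset.HasAntidiagonal.antidiagonal B.card, g m.1 m.2 := by
  rw [Finset.sum_powerset_apply_card
      fun m => (m ! * (B.card - m)! : ℚ) • g m (B.card - m),
    Finset.Nat.sum_antidiagonal_eq_sum_range_succ g, Finset.smul_sum]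
  refine Finset.sum_congr rfl fun m hm => ?_
  rw [← Nat.choose_mul_factorial_mul_factorial (Finset.mem_range_succ_iff.1 hm),
    ← Nat.cast_smul_eq_nsmul ℚ, smul_smul]
  push_cast
  rw [mul_assoc]

section TreeContraction

variable {V κ : Type*} [Fintype κ] {P : Matrix κ κ ℚ}

/-- The propagator of an edge: one half-edge at each end, with labels paired by the symmetric
matrix `P`. -/
def propagator (hP : P.IsSymm) : Sym2 V → MvPolynomial (V × κ) ℚ :=
  Sym2.lift ⟨fun a b => ∑ i, ∑ j, P i j • (MvPolynomial.X (a, i) * MvPolynomial.X (b, j)),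
    fun a b => by
      refine Finset.sum_comm.trans ?_
      refine Finset.sum_congr rfl fun i _ => Finset.sum_congr rfl fun j _ => ?_
      rw [hP.apply, mul_comm]⟩

theorem propagator_mk (hP : P.IsSymm) (a b : V) : propagator hP s(a, b) =
    ∑ i, ∑ j, P i j • (MvPolynomial.X (a, i) * MvPolynomial.X (b, j)) :=
  rfl

theorem sum_propagator (hP : P.IsSymm) (B C : Finset V) :
    ∑ a ∈ B, ∑ b ∈ C, propagator hP s(a, b) = ∑ i, ∑ j, P i j •
      ((∑ a ∈ B, MvPolynomial.X (a, i)) * ∑ b ∈ C, MvPolynomial.X (b, j)) := by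
  simp only [propagator_mk, Finset.sum_mul_sum, Finset.smul_sum]
  rw [Finset.sum_congr rfl fun a _ => Finset.sum_comm, Finset.sum_comm]
  refine Finset.sum_congr rfl fun i _ => ?_
  rw [Finset.sum_congr rfl fun a _ => Finset.sum_comm, Finset.sum_comm]

variable [Fintype V]

theorem treeSum_propagator_mem (hP : P.IsSymm) (B : Finset V) :
    treeSum (propagator hP) B ∈ halfEdgesAt κ B := by
  refine sum_mem fun G hG => ?_
  rw [mem_treesOn] at hG
  refine finprod_mem_induction (· ∈ halfEdgesAt κ B) (one_mem _) (fun _ _ => mul_mem)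
    fun e he => ?_
  induction e with | _ a b
  rw [SimpleGraph.mem_edgeSet] at he
  exact sum_mem fun i _ => sum_mem fun j _ => Subalgebra.smul_mem _
    (mul_mem (X_mem_halfEdgesAt (hG.left_mem he) i) (X_mem_halfEdgesAt (hG.right_mem he) j)) _

variable [DecidableEq V] {A : Type*} [CommRing A] [Algebra ℚ A]

/-- The sum over the trees with vertex set `B` whose vertices carry the jets `J` and whose edges
contract these with `P`. -/
def treeContraction (hP : P.IsSymm) (J : Multiset κ → A) (B : Finset V) : A :=
  contract (fun _ => J) B (treeSum (propagator hP) B)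

theorem treeContraction_empty (hP : P.IsSymm) (J : Multiset κ → A) :
    treeContraction hP J (∅ : Finset V) = 0 := by
  rw [treeContraction, treeSum_empty, map_zero]

theorem treeContraction_singleton (hP : P.IsSymm) (J : Multiset κ → A) (v : V) :
    treeContraction hP J {v} = J 0 := by
  rw [treeContraction, treeSum_singleton, contract_one, Finset.prod_singleton]

variable {J : Multiset κ → A} {D : κ → Derivation ℚ A A}

theorem contract_sum_propagator_mul (hP : P.IsSymm) (hD : ∀ i l, D i (J l) = J (i ::ₘ l))
    {B C : Finset V} (hBC : Disjoint B C) :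
    contract (fun _ => J) (B ∪ C) ((∑ a ∈ B, ∑ b ∈ C, propagator hP s(a, b)) *
        (treeSum (propagator hP) B * treeSum (propagator hP) C)) =
      ∑ i, ∑ j, P i j • (D i (treeContraction hP J B) * D j (treeContraction hP J C)) := by
  have mem (B : Finset V) (i : κ) :
      (∑ a ∈ B, MvPolynomial.X (a, i)) * treeSum (propagator hP) B ∈ halfEdgesAt κ B :=
    mul_mem (sum_mem fun a ha => X_mem_halfEdgesAt ha i) (treeSum_propagator_mem hP B)
  rw [sum_propagator, Finset.sum_mul, map_sum]
  refine Finset.sum_congr rfl fun i _ => ?_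
  rw [Finset.sum_mul, map_sum]
  refine Finset.sum_congr rfl fun j _ => ?_
  rw [smul_mul_assoc, map_smul, mul_mul_mul_comm, contract_mul hBC (mem B i) (mem C j),
    treeContraction, treeContraction, derivation_contract fun _ => hD i,
    derivation_contract fun _ => hD j]

theorem treeContraction_recursion (hP : P.IsSymm) (hD : ∀ i l, D i (J l) = J (i ::ₘ l))
    (B : Finset V) :
    (2 * (B.card - 1 : ℕ) : ℚ) • treeContraction hP J B =
      ∑ C ∈ B.powerset, ∑ i, ∑ j,
        P i j • (D i (treeContraction hP J C) * D j (treeContraction hP J (B \ C))) := by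
  have hrec := congrArg (contract (fun _ => J) B) (treeSum_recursion (propagator hP) B)
  have hscalar : (2 * ((B.card - 1 : ℕ) : MvPolynomial (V × κ) ℚ)) =
      algebraMap ℚ _ (2 * (B.card - 1 : ℕ) : ℚ) := by
    rw [map_mul, map_ofNat, map_natCast]
  rw [hscalar, ← Algebra.smul_def, map_smul] at hrec
  rw [treeContraction, hrec, map_sum]
  refine Finset.sum_congr rfl fun C hC => ?_
  rw [← contract_sum_propagator_mul hP hD Finset.disjoint_sdiff,
    Finset.union_sdiff_of_subset (Finset.mem_powerset.1 hC)]
  simp only [Finset.sum_mul]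

theorem treeContraction_eq_coeff_criticalValue (hP : P.IsSymm)
    (hD : ∀ i l, D i (J l) = J (i ::ₘ l)) {y : κ → A⟦X⟧} (hy : IsCriticalPoint P (scaledJet J) y)
    (B : Finset V) :
    treeContraction hP J B = (B.card ! : ℚ) • coeff B.card (criticalValue P (scaledJet J) y) := by
  set W := criticalValue P (scaledJet J) y
  have hW₀ : coeff 0 W = 0 := coeff_zero_criticalValue
  induction B using Finset.strongInduction with
  | H B ih =>
    rcases lt_trichotomy B.card 1 with hcard | hcard | hcard
    · rw [Finset.card_eq_zero.1 (Nat.lt_one_iff.1 hcard), treeContraction_empty,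
        Finset.card_empty, hW₀, smul_zero]
    · rw [hcard, coeff_one_criticalValue hy, Nat.factorial_one, Nat.cast_one, one_smul]
      obtain ⟨v, rfl⟩ := Finset.card_eq_one.1 hcard
      exact treeContraction_singleton hP J v
    · have term (C : Finset V) (hC : C ∈ B.powerset) :
          ∑ i, ∑ j, P i j • (D i (treeContraction hP J C) * D j (treeContraction hP J (B \ C))) =
            (C.card ! * (B.card - C.card)! : ℚ) • ∑ i, ∑ j, P i j •
              (D i (coeff C.card W) * D j (coeff (B.card - C.card) W)) := by
        rw [Finset.mem_powerset] at hC
        rcases C.eq_empty_or_nonempty with rfl | hC₀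
        · simp [treeContraction_empty, hW₀]
        rcases hC.eq_or_ssubset with rfl | hCB
        · simp [treeContraction_empty, hW₀]
        rw [ih C hCB, ih _ (Finset.sdiff_ssubset hC hC₀), Finset.card_sdiff_of_subset hC]
        simp only [Derivation.map_smul, Finset.smul_sum, smul_mul_smul_comm, smul_smul, mul_comm]
      have hne : (2 * (B.card - 1) : ℚ) ≠ 0 :=
        mul_ne_zero two_ne_zero (sub_ne_zero.2 (by exact_mod_cast hcard.ne'))
      refine (IsUnit.mk0 _ hne).smul_left_cancel.1 ?_
      rw [smul_comm, coeff_criticalValue_recursion hy hP hD, ← sum_powerset_factorial_smul B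
        fun m n => ∑ i, ∑ j, P i j • (D i (coeff m W) * D j (coeff n W)),
        ← Finset.sum_congr rfl term, ← treeContraction_recursion hP hD, Nat.cast_pred (by lia)]

end TreeContraction

section UniversalJets

open scoped PowerSeries.WithPiTopology in
theorem exists_ringHom_extending {A B : Type*} [CommRing A] [CommRing B] (η : A →+* B⟦X⟧) :
    ∃ θ : A⟦X⟧ →+* B⟦X⟧, (∀ a, θ (PowerSeries.C a) = η a) ∧ θ X = X := by
  let : UniformSpace A := ⊥
  let : UniformSpace B := ⊥
  have : DiscreteTopology A := ⟨rfl⟩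
  have : DiscreteUniformity A := ⟨rfl⟩
  have : DiscreteUniformity B := ⟨rfl⟩
  have hX : HasEval (X : B⟦X⟧) := HasEval.X
  have hη : Continuous η := continuous_of_discreteTopology
  refine ⟨eval₂Hom hη hX, fun a => ?_, ?_⟩
  · rw [coe_eval₂Hom, eval₂_C]
  · rw [coe_eval₂Hom, eval₂_X]

theorem X_pow_dvd_sub_sum_range {A : Type*} [CommRing A] (f : A⟦X⟧) (n : ℕ) :
    X ^ n ∣ f - ∑ k ∈ Finset.range n, X ^ k * PowerSeries.C (coeff k f) := by
  rw [X_pow_dvd_iff]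
  intro m hm
  simp [coeff_X_pow, coeff_mul_C, hm]

variable {κ : Type*} {A : Type*} [CommRing A] [Algebra ℚ A]

theorem exists_algHom_scaledJet {J : Multiset κ → A⟦X⟧} (hJ : ∀ l, X ∣ J l) :
    ∃ θ : (MvPolynomial (Multiset κ) ℚ)⟦X⟧ →ₐ[ℚ] A⟦X⟧,
      θ X = X ∧ ∀ l, θ (scaledJet MvPolynomial.X l) = J l := by
  choose J' hJ' using hJ
  obtain ⟨θ, hC, hX⟩ := exists_ringHom_extending
    (MvPolynomial.aeval J' : MvPolynomial (Multiset κ) ℚ →ₐ[ℚ] A⟦X⟧).toRingHom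
  refine ⟨θ.toRatAlgHom, hX, fun l => ?_⟩
  rw [RingHom.toRatAlgHom_apply, scaledJet, map_mul, hX, hC, hJ']
  exact congrArg _ (MvPolynomial.aeval_X J' l)

section Map

variable {V B : Type*} [DecidableEq V] [CommRing B] [Algebra ℚ B]

theorem map_contract (θ : A →ₐ[ℚ] B) (J : V → Multiset κ → A) (s : Finset V)
    (p : MvPolynomial (V × κ) ℚ) :
    θ (contract J s p) = contract (fun v l => θ (J v l)) s p := by
  rw [p.as_sum]
  simp only [map_sum, contract_monomial, map_smul, map_prod]

theorem contract_mul_left (a : A) (J : V → Multiset κ → A) (s : Finset V)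
    (p : MvPolynomial (V × κ) ℚ) :
    contract (fun v l => a * J v l) s p = a ^ s.card * contract J s p := by
  rw [p.as_sum]
  simp only [map_sum, contract_monomial, Finset.prod_mul_distrib, Finset.prod_const,
    Finset.mul_sum, mul_smul_comm]

end Map

variable [Fintype κ] {P : Matrix κ κ ℚ}

theorem treeContraction_scaledJet {V : Type*} [DecidableEq V] [Fintype V] (hP : P.IsSymm)
    (J : Multiset κ → A) (s : Finset V) :
    treeContraction hP (scaledJet J) s =
      X ^ s.card * PowerSeries.C (treeContraction hP J s) := by
  have : scaledJet J = fun l => X * (PowerSeries.C : A →+* A⟦X⟧).toRatAlgHom (J l) := rfl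
  rw [treeContraction, this, contract_mul_left, ← map_contract]
  rfl

theorem X_pow_mul_C_coeff_criticalValue (hP : P.IsSymm) {J : Multiset κ → A}
    {D : κ → Derivation ℚ A A} (hD : ∀ i l, D i (J l) = J (i ::ₘ l)) {y : κ → A⟦X⟧}
    (hy : IsCriticalPoint P (scaledJet J) y) (k : ℕ) :
    X ^ k * PowerSeries.C (coeff k (criticalValue P (scaledJet J) y)) =
      (k ! : ℚ)⁻¹ • treeContraction hP (scaledJet J) (Finset.univ : Finset (Fin k)) := by
  rw [treeContraction_scaledJet, treeContraction_eq_coeff_criticalValue hP hD hy, Finset.card_fin]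
  change _ = (k ! : ℚ)⁻¹ • (X ^ k * (PowerSeries.C : A →+* A⟦X⟧).toRatAlgHom _)
  rw [map_smul, mul_smul_comm, inv_smul_smul₀ (mod_cast k.factorial_ne_zero)]
  rfl

theorem coeff_criticalValue_eq_sum (hP : P.IsSymm) {J : Multiset κ → A⟦X⟧} (hJ : ∀ l, X ∣ J l)
    {y : κ → A⟦X⟧} (hy : IsCriticalPoint P J y) (n : ℕ) :
    coeff n (criticalValue P J y) = ∑ k ∈ Finset.Icc 1 n,
      (k ! : ℚ)⁻¹ • coeff n (treeContraction hP J (Finset.univ : Finset (Fin k))) := by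
  obtain ⟨θ, hX, hθJ⟩ := exists_algHom_scaledJet hJ
  obtain ⟨z, hz, -⟩ := existsUnique_isCriticalPoint P
    (X_dvd_scaledJet (MvPolynomial.X : Multiset κ → MvPolynomial (Multiset κ) ℚ))
  have hθX : X ∣ θ X := hX.symm.dvd
  have hz₀ := hz.X_dvd (X_dvd_scaledJet _)
  have hzy : (fun i => θ (z i)) = y := by
    have := hz.map hθX hz₀
    simp only [hθJ] at this
    exact (existsUnique_isCriticalPoint P hJ).unique this hy
  set W := criticalValue P (scaledJet MvPolynomial.X) z
  have hθW : θ W = criticalValue P J y := by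
    rw [map_criticalValue hθX hz₀, hzy]
    simp only [hθJ]
  have hterm (k : ℕ) : θ (X ^ k * PowerSeries.C (coeff k W)) =
      (k ! : ℚ)⁻¹ • treeContraction hP J (Finset.univ : Finset (Fin k)) := by
    rw [X_pow_mul_C_coeff_criticalValue hP
      (D := fun i => MvPolynomial.mkDerivation ℚ fun l => MvPolynomial.X (i ::ₘ l))
      (fun i l => MvPolynomial.mkDerivation_X ℚ _ l) hz, map_smul, treeContraction, map_contract]
    simp only [hθJ]
    rfl
  have htrunc := X_pow_dvd_iff.1 (X_pow_dvd_map (θ := (θ : _ →+* A⟦X⟧)) hθX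
    (X_pow_dvd_sub_sum_range W (n + 1))) n n.lt_succ_self
  rw [RingHom.coe_coe, map_sub, map_sub, sub_eq_zero, hθW, map_sum, map_sum] at htrunc
  rw [htrunc, Finset.sum_range_eq_add_Ico _ n.succ_pos, hterm, Finset.univ_eq_empty,
    treeContraction_empty, smul_zero, map_zero, zero_add]
  exact Finset.sum_congr rfl fun k _ => by rw [hterm, LinearMap.map_smul_of_tower]

end UniversalJets

section ColouredJets

variable {τ κ A : Type*} [DecidableEq τ] [CommRing A]

/-- The jets of a function of the variables labelled by `κ`, as a function of the variables labelled
by `τ × κ` which only depends on those of colour `c`. -/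
def colourJet (c : τ) (J : Multiset κ → A) (l : Multiset (τ × κ)) : A :=
  if ∀ h ∈ l, h.1 = c then J (l.map Prod.snd) else 0

theorem colourJet_cons (c : τ) (J : Multiset κ → A) (h : τ × κ) (l : Multiset (τ × κ)) :
    colourJet c J (h ::ₘ l) = if h.1 = c then colourJet c (fun l => J (h.2 ::ₘ l)) l else 0 := by
  simp only [colourJet, Multiset.forall_mem_cons, Multiset.map_cons, ite_and]

variable [Fintype τ] [Fintype κ]

theorem taylorTerm_colourJet (c : τ) (J : Multiset κ → A) (y : τ × κ → A) (m : ℕ) :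
    taylorTerm y m (colourJet c J) = taylorTerm (fun i => y (c, i)) m J := by
  induction m generalizing J with
  | zero => simp [taylorTerm, colourJet]
  | succ m ih =>
    have hcons (c' : τ) (i : κ) : taylorTerm y m (fun l => colourJet c J ((c', i) ::ₘ l)) =
        if c' = c then taylorTerm (fun i => y (c, i)) m fun l => J (i ::ₘ l) else 0 := by
      simp only [colourJet_cons]
      split_ifs with h
      · exact ih _
      · exact taylorTerm_sum (∅ : Finset κ) y m fun _ => 0
    simp [taylorTerm_succ, Fintype.sum_prod_type, hcons]

variable [Algebra ℚ A]

theorem formalTaylor_colourJet (c : τ) (J : Multiset κ → A⟦X⟧) (y : τ × κ → A⟦X⟧) :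
    formalTaylor (colourJet c J) y = formalTaylor J fun i => y (c, i) := by
  ext n
  simp only [formalTaylor, taylorPoly, taylorTerm_colourJet]

theorem formalTaylor_sum_colourJet (J : τ → Multiset κ → A⟦X⟧) (y : τ × κ → A⟦X⟧) :
    formalTaylor (fun l => ∑ c, colourJet c (J c) l) y =
      ∑ c, formalTaylor (J c) fun i => y (c, i) := by
  simp only [formalTaylor_sum, formalTaylor_colourJet]

theorem formalGrad_sum_colourJet (J : τ → Multiset κ → A⟦X⟧) (y : τ × κ → A⟦X⟧) (c : τ) (i : κ) :
    formalGrad (fun l => ∑ c, colourJet c (J c) l) y (c, i) =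
      formalGrad (J c) (fun i => y (c, i)) i := by
  simp only [formalGrad, colourJet_cons, Finset.sum_ite_eq, Finset.mem_univ, if_true]
  exact formalTaylor_colourJet c _ y

end ColouredJets

section RestrictColour

variable {V τ κ A : Type*} [DecidableEq V] [CommRing A] [Algebra ℚ A]

theorem labelsAt_mapDomain (s : V × τ × κ →₀ ℕ) (v : V) :
    labelsAt v (s.mapDomain fun h => (h.1, h.2.2)) = (labelsAt v s).map Prod.snd := by
  simp only [labelsAt, AddMonoidHom.coe_mk, ZeroHom.coe_mk]
  rw [← Finsupp.toMultiset_map, Multiset.filter_map, Multiset.map_map, Multiset.map_map]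
  rfl

variable [DecidableEq τ]

/-- The half-edges of the colours prescribed at the vertices by `χ`. -/
def restrictColour (χ : V → τ) :
    MvPolynomial (V × τ × κ) ℚ →ₐ[ℚ] MvPolynomial (V × κ) ℚ :=
  MvPolynomial.aeval fun h => if h.2.1 = χ h.1 then MvPolynomial.X (h.1, h.2.2) else 0

theorem contract_colourJet [Fintype V] (χ : V → τ) (J : V → Multiset κ → A)
    (p : MvPolynomial (V × τ × κ) ℚ) :
    contract (fun v => colourJet (χ v) (J v)) Finset.univ p =
      contract J Finset.univ (restrictColour χ p) := by
  induction p using MvPolynomial.induction_on' with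
  | add p q hp hq => rw [map_add, hp, hq, map_add, map_add]
  | monomial s r =>
    by_cases hs : ∀ h ∈ s.support, h.2.1 = χ h.1
    · have hrename : restrictColour χ (MvPolynomial.monomial s r) =
          MvPolynomial.monomial (s.mapDomain fun h => (h.1, h.2.2)) r := by
        rw [restrictColour, MvPolynomial.aeval_monomial, MvPolynomial.monomial_eq,
          Finsupp.prod_mapDomain_index (fun _ => pow_zero _) fun _ _ _ => pow_add _ _ _]
        exact congrArg _ (Finset.prod_congr rfl fun h hh => congrArg (· ^ s h) (if_pos (hs h hh)))
      rw [hrename, contract_monomial, contract_monomial]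
      refine congrArg _ (Finset.prod_congr rfl fun v _ => ?_)
      rw [colourJet, if_pos fun h hh => hs (v, h) (mem_labelsAt.1 hh), labelsAt_mapDomain]
    · push Not at hs
      obtain ⟨⟨v, h⟩, hmem, hne⟩ := hs
      have hzero : restrictColour χ (MvPolynomial.monomial s r) = (0 : MvPolynomial (V × κ) ℚ) := by
        rw [restrictColour, MvPolynomial.aeval_monomial, Finsupp.prod, Finset.prod_eq_zero hmem,
          mul_zero]
        rw [if_neg hne, zero_pow (Finsupp.mem_support_iff.1 hmem)]
      rw [hzero, map_zero, contract_monomial, Finset.prod_eq_zero (Finset.mem_univ v), smul_zero]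
      exact if_neg fun hall => hne (hall h (mem_labelsAt.2 hmem))

theorem contract_sum_colourJet [Fintype V] [Fintype τ] (J : τ → Multiset κ → A)
    (p : MvPolynomial (V × τ × κ) ℚ) :
    contract (fun _ l => ∑ c, colourJet c (J c) l) (Finset.univ : Finset V) p =
      ∑ χ : V → τ, contract (fun v => J (χ v)) Finset.univ (restrictColour χ p) := by
  simp only [← contract_colourJet]
  rw [p.as_sum]
  simp only [map_sum, contract_monomial, Finset.prod_univ_sum, Fintype.piFinset_univ,
    Finset.smul_sum]
  exact Finset.sum_comm

end RestrictColour

section BipartiteTrees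

/-- The pairing of each variable with the variable of the other colour with the same label. -/
def bipartitePairing (ι : Type*) [DecidableEq ι] : Matrix (Colour × ι) (Colour × ι) ℚ :=
  .of fun a b => if a.1 ≠ b.1 ∧ a.2 = b.2 then 1 else 0

theorem isSymm_bipartitePairing (ι : Type*) [DecidableEq ι] : (bipartitePairing ι).IsSymm := by
  ext a b
  simp only [bipartitePairing, Matrix.transpose_apply, Matrix.of_apply, ne_comm, eq_comm]

theorem contract_prod_sum {V ι : Type*} [DecidableEq V] [Fintype ι] {A E : Type*} [CommRing A]
    [Algebra ℚ A] [Fintype E] [DecidableEq E] (J : V → Multiset ι → A) (B : Finset V)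
    (ends : E → Finset V) :
    contract J B (∏ e, ∑ i, ∏ v ∈ ends e, MvPolynomial.X (v, i)) =
      ∑ β : E → ι, ∏ v ∈ B, J v ((Finset.univ.filter (v ∈ ends ·)).val.map β) := by
  rw [Finset.prod_univ_sum, Fintype.piFinset_univ, map_sum]
  refine Finset.sum_congr rfl fun β _ => ?_
  have hmonomial : ∏ e, ∏ v ∈ ends e, (MvPolynomial.X (v, β e) : MvPolynomial (V × ι) ℚ) =
      MvPolynomial.monomial (∑ e, ∑ v ∈ ends e, Finsupp.single (v, β e) 1) 1 := by
    simp only [MvPolynomial.monomial_sum_one, MvPolynomial.X]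
  rw [hmonomial, contract_monomial, one_smul]
  refine Finset.prod_congr rfl fun v _ => congrArg _ ?_
  simp only [map_sum, labelsAt_single, Finset.sum_ite_eq', ← Finset.sum_filter]
  rw [← Multiset.sum_map_singleton (Multiset.map β _), Multiset.map_map]
  rfl

variable {V ι : Type*} [DecidableEq ι] [Fintype ι]

theorem restrictColour_propagator (χ : V → Colour) (a b : V) :
    restrictColour χ (propagator (isSymm_bipartitePairing ι) s(a, b)) =
      if χ a ≠ χ b then ∑ i, MvPolynomial.X (a, i) * MvPolynomial.X (b, i) else 0 := by
  simp only [propagator_mk, Fintype.sum_prod_type, map_sum, map_smul, map_mul, restrictColour,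
    MvPolynomial.aeval_X, bipartitePairing, Matrix.of_apply]
  have (c c' : Colour) (i j : ι) : (if c ≠ c' ∧ i = j then (1 : ℚ) else 0) •
      ((if c = χ a then MvPolynomial.X (a, i) else 0 : MvPolynomial (V × ι) ℚ) *
        if c' = χ b then MvPolynomial.X (b, j) else 0) =
      if c = χ a then if c' = χ b then if i = j then if χ a ≠ χ b then
        MvPolynomial.X (a, i) * MvPolynomial.X (b, j) else 0 else 0 else 0 else 0 := by
    split_ifs <;> simp_all
  simp only [this]
  simp

theorem restrictColour_edgeWeight [DecidableEq V] (χ : V → Colour) (G : SimpleGraph V)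
    [Fintype G.edgeSet] [Decidable (∀ v w, G.Adj v w → χ v ≠ χ w)] :
    restrictColour χ (edgeWeight (propagator (isSymm_bipartitePairing ι)) G) =
      if ∀ v w, G.Adj v w → χ v ≠ χ w then
        ∏ e : G.edgeSet, ∑ i, ∏ v ∈ (e : Sym2 V).toFinset, MvPolynomial.X (v, i) else 0 := by
  rw [edgeWeight, ← finprod_set_coe_eq_finprod_mem, finprod_eq_prod_of_fintype, map_prod]
  split_ifs with h
  · refine Finset.prod_congr rfl fun ⟨e, he⟩ _ => ?_
    induction e with | _ a b
    rw [SimpleGraph.mem_edgeSet] at he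
    rw [restrictColour_propagator, if_pos (h a b he)]
    exact Finset.sum_congr rfl fun i _ => by
      rw [Sym2.toFinset_mk_eq, Finset.prod_pair he.ne]
  · push Not at h
    obtain ⟨a, b, hab, heq⟩ := h
    refine Finset.prod_eq_zero (Finset.mem_univ ⟨s(a, b), hab⟩) ?_
    rw [restrictColour_propagator, if_neg (not_not.2 heq)]

theorem treeContraction_sum_colourJet {A : Type*} [CommRing A] [Algebra ℚ A] {k : ℕ}
    (J : Colour → Multiset ι → A) :
    treeContraction (isSymm_bipartitePairing ι) (fun l => ∑ c, colourJet c (J c) l)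
        (Finset.univ : Finset (Fin k)) =
      ∑ t : BipartiteTree k, ∑ β : t.graph.edgeSet → ι,
        ∏ v, J (t.colour v) ((t.edgesAt v).map β : List ι) := by
  classical
  let value (x : SimpleGraph (Fin k) × (Fin k → Colour)) : A :=
    contract (fun v => J (x.2 v)) Finset.univ
      (restrictColour x.2 (edgeWeight (propagator (isSymm_bipartitePairing ι)) x.1))
  have value_eq_zero (x : SimpleGraph (Fin k) × (Fin k → Colour)) (hx : value x ≠ 0) :
      ∀ v w, x.1.Adj v w → x.2 v ≠ x.2 w := by
    contrapose! hx
    simp only [value, restrictColour_edgeWeight]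
    rw [if_neg (by push Not; exact hx), map_zero]
  have value_eq (t : BipartiteTree k) : value t.1 = ∑ β : t.graph.edgeSet → ι,
      ∏ v, J (t.colour v) ((t.edgesAt v).map β : List ι) := by
    change contract (fun v => J (t.colour v)) Finset.univ
      (restrictColour t.colour (edgeWeight (propagator (isSymm_bipartitePairing ι)) t.graph)) = _
    have hproper : ∀ v w, t.graph.Adj v w → t.colour v ≠ t.colour w := t.2.2
    rw [restrictColour_edgeWeight, if_pos hproper, contract_prod_sum]
    refine Finset.sum_congr rfl fun β _ => Finset.prod_congr rfl fun v _ => congrArg _ ?_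
    rw [BipartiteTree.edgesAt, ← Multiset.map_coe, Finset.coe_toList]
    simp only [Sym2.mem_toFinset]
  calc treeContraction (isSymm_bipartitePairing ι) (fun l => ∑ c, colourJet c (J c) l) Finset.univ
      = ∑ x ∈ treesOn Finset.univ ×ˢ Finset.univ, value x := by
        rw [treeContraction, contract_sum_colourJet, treeSum, Finset.sum_product_right]
        simp only [map_sum, value]
    _ = ∑ t : BipartiteTree k, value t.1 := by
        rw [← Finset.sum_filter_of_ne fun x _ => value_eq_zero x]
        refine Finset.sum_subtype _ (fun x => ?_) value
        rw [Finset.mem_filter, Finset.mem_product, mem_treesOn, isTreeOn_univ_iff]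
        simp only [Finset.mem_univ, and_true]
    _ = _ := Finset.sum_congr rfl fun t _ => value_eq t

end BipartiteTrees

section BipartiteCriticalValue

/-- The opposite colour. -/
def Colour.other : Colour → Colour
  | .white => .black
  | .black => .white

theorem Colour.forall_iff {p : Colour → Prop} : (∀ c, p c) ↔ p .white ∧ p .black :=
  ⟨fun h => ⟨h _, h _⟩, fun h c => by cases c; exacts [h.1, h.2]⟩

theorem Colour.sum_eq {M : Type*} [AddCommMonoid M] (f : Colour → M) :
    ∑ c, f c = f .white + f .black :=
  Finset.sum_pair (by decide)

variable {ι A : Type*} [DecidableEq ι] [Fintype ι] [CommRing A] [Algebra ℚ A]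
  {J : Colour → Multiset ι → A⟦X⟧} {y : Colour × ι → A⟦X⟧}

theorem sum_bipartitePairing_smul (f : Colour × ι → A) (c : Colour) (i : ι) :
    ∑ h, bipartitePairing ι (c, i) h • f h = f (c.other, i) := by
  cases c <;>
    simp [bipartitePairing, Fintype.sum_prod_type, Colour.sum_eq, Colour.other]

theorem isCriticalPoint_bipartitePairing_iff :
    IsCriticalPoint (bipartitePairing ι) (fun l => ∑ c, colourJet c (J c) l) y ↔
      ∀ c i, y (c.other, i) = formalGrad (J c) (fun i => y (c, i)) i := by
  simp only [IsCriticalPoint, sum_bipartitePairing_smul, formalGrad_sum_colourJet, Prod.forall]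
  rw [Colour.forall_iff, Colour.forall_iff, and_comm]
  rfl

theorem IsCriticalPoint.criticalValue_bipartitePairing
    (h : IsCriticalPoint (bipartitePairing ι) (fun l => ∑ c, colourJet c (J c) l) y) :
    criticalValue (bipartitePairing ι) (fun l => ∑ c, colourJet c (J c) l) y =
      ∑ c, formalTaylor (J c) (fun i => y (c, i)) - ∑ i, y (.white, i) * y (.black, i) := by
  have quadratic : ∑ h, ∑ h', bipartitePairing ι h h' •
      (formalGrad (fun l => ∑ c, colourJet c (J c) l) y h *
        formalGrad (fun l => ∑ c, colourJet c (J c) l) y h') =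
      (2 : ℚ) • ∑ i, y (.white, i) * y (.black, i) := by
    rw [isCriticalPoint_bipartitePairing_iff] at h
    rw [Fintype.sum_prod_type]
    simp only [sum_bipartitePairing_smul, formalGrad_sum_colourJet, ← h]
    simp only [Colour.sum_eq, Colour.other, two_smul, mul_comm (y (.black, _))]
  rw [criticalValue, quadratic, formalTaylor_sum_colourJet, smul_smul,
    inv_mul_cancel₀ two_ne_zero, one_smul]

end BipartiteCriticalValue

section PositivePart

variable {A : Type*} [CommRing A]

/-- The formal series `∑ₙ hⁿ gₙ` without its constant term. -/
def positivePart (g : ℕ → A) : A⟦X⟧ :=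
  PowerSeries.mk fun n => if n = 0 then 0 else g n

theorem coeff_positivePart (g : ℕ → A) (n : ℕ) :
    coeff n (positivePart g) = if n = 0 then 0 else g n := coeff_mk _ _

theorem X_dvd_positivePart (g : ℕ → A) : X ∣ positivePart g := by
  rw [X_dvd_iff, ← coeff_zero_eq_constantCoeff_apply, coeff_positivePart, if_pos rfl]

theorem mk_eq_C_add_positivePart (g : ℕ → A) :
    PowerSeries.mk g = PowerSeries.C (g 0) + positivePart g := by
  ext n
  rw [map_add, coeff_mk, coeff_C, coeff_positivePart]
  split_ifs with h <;> simp [h]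

theorem coeff_prod_positivePart {k : ℕ} (g : Fin k → ℕ → A) (n : ℕ) :
    coeff n (∏ v, positivePart (g v)) = ∑ ν ∈ compositions k n, ∏ v, g v (ν v) := by
  rw [PowerSeries.coeff_prod, compositions, Finset.sum_filter]
  refine Finset.sum_equiv Finsupp.equivFunOnFinite (fun l => by simp) fun l _ => ?_
  simp only [coeff_positivePart, Finsupp.equivFunOnFinite_apply]
  split_ifs with h
  · exact Finset.prod_congr rfl fun v _ => if_neg (Nat.one_le_iff_ne_zero.1 (h v))
  · push Not at h
    obtain ⟨v, hv⟩ := h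
    exact Finset.prod_eq_zero (Finset.mem_univ v) (if_pos (Nat.lt_one_iff.1 hv))

theorem coeff_treeContraction_positivePart {ι : Type*} [Fintype ι] [DecidableEq ι] [Algebra ℚ A]
    {k : ℕ} (g : Colour → ℕ → Multiset ι → A) (n : ℕ) :
    coeff n (treeContraction (isSymm_bipartitePairing ι)
      (fun l => ∑ c, colourJet c (fun l => positivePart fun n => g c n l) l)
      (Finset.univ : Finset (Fin k))) =
      ∑ t : BipartiteTree k, ∑ ν ∈ compositions k n, ∑ β : t.graph.edgeSet → ι,
        ∏ v, g (t.colour v) (ν v) ((t.edgesAt v).map β : List ι) := by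
  rw [treeContraction_sum_colourJet, map_sum]
  refine Finset.sum_congr rfl fun t _ => ?_
  rw [map_sum, Finset.sum_comm]
  exact Finset.sum_congr rfl fun β _ => coeff_prod_positivePart _ n

end PositivePart

section PartialDerivatives

variable {d : ℕ} {f : B₂ d → ℝ}

theorem contDiff_partialDeriv (hf : ContDiff ℝ ∞ f) (c : Fin 3 × Fin d) :
    ContDiff ℝ ∞ (partialDeriv c f) :=
  (hf.fderiv_right (m := ∞) (by norm_num)).clm_apply contDiff_const

theorem contDiff_mixedPartial (hf : ContDiff ℝ ∞ f) (l : List (Fin 3 × Fin d)) :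
    ContDiff ℝ ∞ (mixedPartial l f) := by
  induction l with
  | nil => exact hf
  | cons c l ih => exact contDiff_partialDeriv ih c

theorem partialDeriv_comm (hf : ContDiff ℝ ∞ f) (c c' : Fin 3 × Fin d) :
    partialDeriv c (partialDeriv c' f) = partialDeriv c' (partialDeriv c f) := by
  funext y
  have differentiable_fderiv : DifferentiableAt ℝ (fderiv ℝ f) y :=
    (hf.fderiv_right (m := ∞) (by norm_num)).differentiable (by simp) y
  have second (v w : B₂ d) :
      fderiv ℝ (fun z => fderiv ℝ f z v) y w = fderiv ℝ (fderiv ℝ f) y w v := by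
    rw [fderiv_clm_apply differentiable_fderiv (differentiableAt_const v)]
    simp
  have contDiff_two : ContDiff ℝ 2 f := hf.of_le (WithTop.coe_le_coe.2 le_top)
  unfold partialDeriv
  rw [second, second]
  exact contDiff_two.contDiffAt.isSymmSndFDerivAt (by simp) _ _

theorem mixedPartial_perm (hf : ContDiff ℝ ∞ f) {l l' : List (Fin 3 × Fin d)} (h : l.Perm l') :
    mixedPartial l f = mixedPartial l' f := by
  induction h with
  | nil => rfl
  | cons c _ ih => exact congr_arg (partialDeriv c) ih
  | swap c c' l => exact partialDeriv_comm (contDiff_mixedPartial hf l) _ _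
  | trans _ _ ih ih' => exact ih.trans ih'

theorem partialDeriv_eq_of_line (hf : ContDiff ℝ ∞ f) {c : Fin 3 × Fin d} {y : B₂ d} {L : ℝ}
    (h : ∀ t : ℝ, f (y + t • (Pi.single c.1 (Pi.single c.2 1) : B₂ d)) = f y + t * L) :
    partialDeriv c f y = L := by
  rw [partialDeriv, ← (hf.differentiable (by simp) y).lineDeriv_eq_fderiv, lineDeriv]
  simp_rw [h]
  simp

/-- The jet of `f` at `P`: its iterated partial derivatives along the coordinates of a multiset.
The multiset is sorted arbitrarily, which does not matter for smooth `f`. -/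
def jet (f : B₂ d → ℝ) (P : B₂ d) (l : Multiset (Fin 3 × Fin d)) : ℝ :=
  mixedPartial l.toList f P

theorem jet_coe (hf : ContDiff ℝ ∞ f) (P : B₂ d) (l : List (Fin 3 × Fin d)) :
    jet f P l = mixedPartial l f P := by
  rw [jet, mixedPartial_perm hf (Multiset.coe_eq_coe.1 (Multiset.coe_toList _))]

theorem jet_zero (f : B₂ d → ℝ) (P : B₂ d) : jet f P 0 = f P := by
  rw [jet, Multiset.toList_zero, mixedPartial, List.foldr_nil]

theorem jet_cons (hf : ContDiff ℝ ∞ f) (P : B₂ d) (c : Fin 3 × Fin d)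
    (l : Multiset (Fin 3 × Fin d)) : jet f P (c ::ₘ l) = jet (partialDeriv c f) P l := by
  induction l using Quotient.inductionOn with | _ l
  rw [Multiset.quot_mk_to_coe, Multiset.cons_coe, jet_coe hf, jet_coe (contDiff_partialDeriv hf c),
    mixedPartial_perm hf (List.perm_append_singleton c l).symm]
  simp only [mixedPartial, List.foldr_append, List.foldr_cons, List.foldr_nil]

theorem jet_const_zero (P : B₂ d) (l : Multiset (Fin 3 × Fin d)) : jet (fun _ => 0) P l = 0 := by
  have vanish (l : List (Fin 3 × Fin d)) :
      mixedPartial l (fun _ : B₂ d => (0 : ℝ)) = fun _ => 0 := by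
    induction l with
    | nil => rfl
    | cons c l ih =>
      rw [mixedPartial, List.foldr_cons, ← mixedPartial, ih]
      funext y
      simp [partialDeriv]
  rw [jet, vanish]

end PartialDerivatives

section Bilinear

variable {d : ℕ}

/-- The unperturbed generating function `S₀ = x (p₁ + p₂)`. -/
def bilinearForm (y : B₂ d) : ℝ := y 2 ⬝ᵥ (y 0 + y 1)

/-- The gradient of `bilinearForm` with respect to slot `s`. -/
def bilinearGrad (s : Fin 3) (y : B₂ d) : Fin d → ℝ :=
  if s = 2 then y 0 + y 1 else y 2

theorem bilinearGrad_update (s : Fin 3) (y : B₂ d) (v : Fin d → ℝ) :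
    bilinearGrad s (Function.update y s v) = bilinearGrad s y := by
  fin_cases s <;> simp [bilinearGrad]

theorem contDiff_bilinearForm : ContDiff ℝ ∞ (bilinearForm : B₂ d → ℝ) := by
  unfold bilinearForm
  simp only [dotProduct, Pi.add_apply]
  fun_prop

theorem partialDeriv_bilinearForm (s : Fin 3) (i : Fin d) :
    partialDeriv (s, i) (bilinearForm : B₂ d → ℝ) = fun y => bilinearGrad s y i := by
  funext y
  refine partialDeriv_eq_of_line contDiff_bilinearForm fun t => ?_
  fin_cases s
  · simp [bilinearForm, bilinearGrad, dotProduct_add, add_right_comm]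
  · simp [bilinearForm, bilinearGrad, dotProduct_add, add_assoc]
  · simp [bilinearForm, bilinearGrad, add_dotProduct]
    ring

theorem contDiff_bilinearGrad (s : Fin 3) (i : Fin d) :
    ContDiff ℝ ∞ fun y : B₂ d => bilinearGrad s y i := by
  rw [← partialDeriv_bilinearForm]
  exact contDiff_partialDeriv contDiff_bilinearForm _

theorem partialDeriv_bilinearGrad (s : Fin 3) (i j : Fin d) :
    partialDeriv (s, j) (fun y : B₂ d => bilinearGrad s y i) = fun _ => 0 := by
  funext y
  refine partialDeriv_eq_of_line (contDiff_bilinearGrad s i) fun t => ?_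
  fin_cases s <;> simp [bilinearGrad]

theorem jet_bilinearForm_singleton (P : B₂ d) (s : Fin 3) (i : Fin d) :
    jet (bilinearForm : B₂ d → ℝ) P {(s, i)} = bilinearGrad s P i := by
  rw [← Multiset.cons_zero, jet_cons contDiff_bilinearForm, partialDeriv_bilinearForm, jet_zero]

theorem jet_bilinearForm_cons_cons (P : B₂ d) (s : Fin 3) (i j : Fin d)
    (l : Multiset (Fin 3 × Fin d)) :
    jet (bilinearForm : B₂ d → ℝ) P ((s, i) ::ₘ (s, j) ::ₘ l) = 0 := by
  rw [jet_cons contDiff_bilinearForm, partialDeriv_bilinearForm,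
    jet_cons (contDiff_bilinearGrad s i), partialDeriv_bilinearGrad, jet_const_zero]

end Bilinear

section Substitution

variable {d : ℕ}

theorem taylorSubst_eq_formalTaylor {f : B₂ d → ℝ} (hf : ContDiff ℝ ∞ f)
    (y : Fin 3 → Fin d → ℝ⟦X⟧) :
    taylorSubst f y = formalTaylor (fun l => PowerSeries.C (jet f (constTerm y) l))
      fun c => y c.1 c.2 - PowerSeries.C (constTerm y c.1 c.2) := by
  ext n
  rw [taylorSubst, formalTaylor, coeff_mk, coeff_mk, taylorPoly, map_sum]
  refine Finset.sum_congr rfl fun m _ => ?_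
  rw [taylorTerm_eq_sum, LinearMap.map_smul_of_tower, map_sum, Rat.smul_def]
  simp only [coeff_C_mul, jet_coe hf]
  push_cast
  rfl

theorem seriesSubst_eq_formalTaylor {S : ℕ → B₂ d → ℝ} (hS : ∀ n, ContDiff ℝ ∞ (S n))
    (y : Fin 3 → Fin d → ℝ⟦X⟧) :
    seriesSubst S y = formalTaylor (fun l => PowerSeries.mk fun n => jet (S n) (constTerm y) l)
      fun c => y c.1 c.2 - PowerSeries.C (constTerm y c.1 c.2) := by
  rw [formalTaylor_mk fun c => X_dvd_iff.2 (by simp [constTerm])]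
  simp only [seriesSubst, taylorSubst_eq_formalTaylor (hS _)]

/-- The formal point whose slot `s` is `v` and whose other slots are those of `P`. -/
def slotPoint (s : Fin 3) (P : B₂ d) (v : Fin d → ℝ⟦X⟧) : Fin 3 → Fin d → ℝ⟦X⟧ :=
  Function.update (fun s => const (P s)) s v

theorem constTerm_slotPoint (s : Fin 3) (P : B₂ d) (v : Fin d → ℝ⟦X⟧) :
    constTerm (slotPoint s P v) = Function.update P s fun i => constantCoeff (v i) := by
  funext s' i
  by_cases h : s' = s
  · subst h
    simp [constTerm, slotPoint]
  · simp [constTerm, slotPoint, h, const]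

/-- The derivatives of `S_h` at `P` with respect to the coordinates of slot `s`. -/
def slotJet (S : ℕ → B₂ d → ℝ) (s : Fin 3) (P : B₂ d) (l : Multiset (Fin d)) : ℝ⟦X⟧ :=
  PowerSeries.mk fun n => jet (S n) P (l.map (Prod.mk s))

/-- The part of `slotJet` that comes from the perturbation `∑_{n ≥ 1} hⁿ Sₙ`. -/
def perturbationJet (S : ℕ → B₂ d → ℝ) (s : Fin 3) (P : B₂ d) (l : Multiset (Fin d)) : ℝ⟦X⟧ :=
  positivePart fun n => jet (S n) P (l.map (Prod.mk s))

variable {S : ℕ → B₂ d → ℝ} (s : Fin 3) (P : B₂ d)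

theorem slotJet_eq_add (h0 : S 0 = bilinearForm) (l : Multiset (Fin d)) :
    slotJet S s P l =
      PowerSeries.C (jet bilinearForm P (l.map (Prod.mk s))) + perturbationJet S s P l := by
  rw [slotJet, mk_eq_C_add_positivePart, h0, perturbationJet]

variable {z : Fin d → ℝ⟦X⟧} (hz : ∀ i, X ∣ z i)

include hz

theorem seriesSubst_slotPoint (hS : ∀ n, ContDiff ℝ ∞ (S n)) :
    seriesSubst S (slotPoint s P fun i => PowerSeries.C (P s i) + z i) =
      formalTaylor (slotJet S s P) z := by
  have base : constTerm (slotPoint s P fun i => PowerSeries.C (P s i) + z i) = P := by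
    simp [constTerm_slotPoint, fun i => X_dvd_iff.1 (hz i)]
  rw [seriesSubst_eq_formalTaylor hS, base]
  ext n
  simp only [formalTaylor, coeff_mk, taylorPoly]
  refine congrArg (coeff n) (Finset.sum_congr rfl fun m _ => congrArg _ ?_)
  rw [taylorTerm_comp_prodMk (c := s)]
  · simp only [slotPoint, Function.update_self, add_sub_cancel_left]
    rfl
  · intro s' i h
    simp [slotPoint, h, const]

theorem seriesGrad_slotPoint (hS : ∀ n, ContDiff ℝ ∞ (S n)) (i : Fin d) :
    seriesGrad s S (slotPoint s P fun i => PowerSeries.C (P s i) + z i) i =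
      formalGrad (slotJet S s P) z i := by
  rw [seriesGrad, seriesSubst_slotPoint s P hz fun n => contDiff_partialDeriv (hS n) _,
    formalGrad]
  simp only [slotJet, Multiset.map_cons, jet_cons (hS _)]
  rfl

theorem formalTaylor_slotJet (h0 : S 0 = bilinearForm) :
    formalTaylor (slotJet S s P) z = PowerSeries.C (bilinearForm P) +
      ∑ i, z i * PowerSeries.C (bilinearGrad s P i) + formalTaylor (perturbationJet S s P) z := by
  rw [funext (slotJet_eq_add s P h0), formalTaylor_add, formalTaylor_of_affine hz]
  · simp [jet_zero, jet_bilinearForm_singleton]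
  · intro i j l
    rw [Multiset.map_cons, Multiset.map_cons, jet_bilinearForm_cons_cons, map_zero]

theorem formalGrad_slotJet (h0 : S 0 = bilinearForm) (i : Fin d) :
    formalGrad (slotJet S s P) z i = PowerSeries.C (bilinearGrad s P i) +
      formalGrad (perturbationJet S s P) z i := by
  have linear (j : Fin d) : jet bilinearForm P ((s, i) ::ₘ {(s, j)}) = 0 :=
    jet_bilinearForm_cons_cons P s i j 0
  simp only [formalGrad, slotJet_eq_add s P h0]
  rw [formalTaylor_add, formalTaylor_of_affine hz]
  · simp [jet_bilinearForm_singleton, linear]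
  · intro j k l
    rw [Multiset.map_cons, Multiset.map_cons, jet_bilinearForm_cons_cons, map_zero]

end Substitution

section Sides

variable {d : ℕ}

/-- The implicit equations of side `i` for the formal points `u .white` and `u .black`, which take
the place of slot `slot i c` of the base point of colour `c`: these are `x̄, p̄` on the first side
and `x̃, p̃` on the second. -/
def IsSolution (S : ℕ → B₂ d → ℝ) (i : Side) (P : Colour → B₂ d)
    (u : Colour → Fin d → ℝ⟦X⟧) : Prop :=
  ∀ c, u c.other = seriesGrad (slot i c) S (slotPoint (slot i c) (P c) (u c))

/-- The corresponding side of the SGA equation. -/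
def sideValue (S : ℕ → B₂ d → ℝ) (i : Side) (P : Colour → B₂ d)
    (u : Colour → Fin d → ℝ⟦X⟧) : ℝ⟦X⟧ :=
  ∑ c, seriesSubst S (slotPoint (slot i c) (P c) (u c)) - u .white ⬝ᵥ u .black

/-- The jets of the perturbations at the two base points of side `i`, in the variables of the slots
with respect to which they are differentiated. -/
def sideJet (S : ℕ → B₂ d → ℝ) (i : Side) (P : Colour → B₂ d)
    (l : Multiset (Colour × Fin d)) : ℝ⟦X⟧ :=
  ∑ c, colourJet c (perturbationJet S (slot i c) (P c)) l

theorem X_dvd_sideJet (S : ℕ → B₂ d → ℝ) (i : Side) (P : Colour → B₂ d)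
    (l : Multiset (Colour × Fin d)) : X ∣ sideJet S i P l := by
  refine Finset.dvd_sum fun c _ => ?_
  rw [colourJet]
  split_ifs
  exacts [X_dvd_positivePart _, dvd_zero _]

/-- The pair of formal points with increment `y` over the base points `P`. -/
def displace (i : Side) (P : Colour → B₂ d) (y : Colour × Fin d → ℝ⟦X⟧) (c : Colour)
    (k : Fin d) : ℝ⟦X⟧ :=
  PowerSeries.C (P c (slot i c) k) + y (c, k)

theorem satisfies_iff_exists_isSolution {S : ℕ → B₂ d → ℝ} :
    Satisfies S ↔ ∀ p₁ p₂ p₃ x, ∃ u v,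
      IsSolution S .first (basePoint p₁ p₂ p₃ x .first) u ∧
      IsSolution S .second (basePoint p₁ p₂ p₃ x .second) v ∧
      sideValue S .first (basePoint p₁ p₂ p₃ x .first) u =
        sideValue S .second (basePoint p₁ p₂ p₃ x .second) v := by
  have zero (a b c : Fin d → ℝ) (w : Fin d → ℝ⟦X⟧) :
      slotPoint 0 ![a, b, c] w = ![w, const b, const c] := by
    funext s; fin_cases s <;> rfl
  have one (a b c : Fin d → ℝ) (w : Fin d → ℝ⟦X⟧) :
      slotPoint 1 ![a, b, c] w = ![const a, w, const c] := by
    funext s; fin_cases s <;> rfl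
  have two (a b c : Fin d → ℝ) (w : Fin d → ℝ⟦X⟧) :
      slotPoint 2 ![a, b, c] w = ![const a, const b, w] := by
    funext s; fin_cases s <;> rfl
  refine forall₄_congr fun p₁ p₂ p₃ x => ?_
  simp only [IsSolution, sideValue, Colour.forall_iff, Colour.sum_eq, Colour.other, slot,
    basePoint, zero, one, two]
  constructor
  · rintro ⟨xb, pb, xt, pt, hxb, hpb, hxt, hpt, h⟩
    exact ⟨fun | .white => xb | .black => pb, fun | .white => xt | .black => pt,
      ⟨hpb, hxb⟩, ⟨hpt, hxt⟩, h⟩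
  · rintro ⟨u, v, ⟨hpb, hxb⟩, ⟨hpt, hxt⟩, h⟩
    exact ⟨_, _, _, _, hxb, hpb, hxt, hpt, h⟩

theorem bilinearGrad_basePoint (p₁ p₂ p₃ x : Fin d → ℝ) (i : Side) (c : Colour) :
    bilinearGrad (slot i c) (basePoint p₁ p₂ p₃ x i c) =
      basePoint p₁ p₂ p₃ x i c.other (slot i c.other) := by
  cases i <;> cases c <;> rfl

theorem sum_bilinearForm_basePoint (p₁ p₂ p₃ x : Fin d → ℝ) (i : Side) :
    ∑ c, bilinearForm (basePoint p₁ p₂ p₃ x i c) -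
        basePoint p₁ p₂ p₃ x i .white (slot i .white) ⬝ᵥ
          basePoint p₁ p₂ p₃ x i .black (slot i .black) = x ⬝ᵥ (p₁ + p₂ + p₃) := by
  cases i
  · simp [Colour.sum_eq, bilinearForm, basePoint, slot, dotProduct_add]
  · simp [Colour.sum_eq, bilinearForm, basePoint, slot, dotProduct_add]
    ring

variable {S : ℕ → B₂ d → ℝ} (h0 : S 0 = bilinearForm) {i : Side} {P : Colour → B₂ d}
  (hP : ∀ c, bilinearGrad (slot i c) (P c) = P c.other (slot i c.other))

include h0 hP

theorem IsSolution.exists_displace {u : Colour → Fin d → ℝ⟦X⟧} (hu : IsSolution S i P u) :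
    ∃ y, (∀ h, X ∣ y h) ∧ u = displace i P y := by
  have constantCoeff_eq (c : Colour) (k : Fin d) :
      constantCoeff (u c.other k) = P c.other (slot i c.other) k := by
    rw [hu c, seriesGrad, ← coeff_zero_eq_constantCoeff_apply, seriesSubst, coeff_mk]
    simp [taylorSubst, mixedPartial, h0, partialDeriv_bilinearForm, constTerm_slotPoint,
      bilinearGrad_update, hP]
  refine ⟨fun h => u h.1 h.2 - PowerSeries.C (P h.1 (slot i h.1) h.2), fun ⟨c, k⟩ => ?_,
    funext₂ fun c k => (add_sub_cancel _ _).symm⟩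
  rw [X_dvd_iff, map_sub, constantCoeff_C, sub_eq_zero]
  cases c
  exacts [constantCoeff_eq .black k, constantCoeff_eq .white k]

variable (hS : ∀ n, ContDiff ℝ ∞ (S n)) {y : Colour × Fin d → ℝ⟦X⟧}

include hS

theorem isSolution_displace_iff (hy : ∀ h, X ∣ y h) :
    IsSolution S i P (displace i P y) ↔
      IsCriticalPoint (bipartitePairing (Fin d)) (sideJet S i P) y := by
  rw [show sideJet S i P = fun l => ∑ c, colourJet c _ l from rfl,
    isCriticalPoint_bipartitePairing_iff]
  refine forall_congr' fun c => funext_iff.trans (forall_congr' fun k => ?_)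
  have gradient := (seriesGrad_slotPoint (slot i c) (P c) (fun k => hy (c, k)) hS k).trans
    (formalGrad_slotJet _ _ (fun k => hy (c, k)) h0 k)
  rw [hP] at gradient
  exact (Eq.congr_right gradient).trans (add_right_inj _)

theorem IsCriticalPoint.sideValue_displace
    (h : IsCriticalPoint (bipartitePairing (Fin d)) (sideJet S i P) y) :
    sideValue S i P (displace i P y) = PowerSeries.C (∑ c, bilinearForm (P c) -
        P .white (slot i .white) ⬝ᵥ P .black (slot i .black)) +
      criticalValue (bipartitePairing (Fin d)) (sideJet S i P) y := by
  have hy := h.X_dvd (X_dvd_sideJet S i P)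
  have value (c : Colour) : seriesSubst S (slotPoint (slot i c) (P c) (displace i P y c)) =
      PowerSeries.C (bilinearForm (P c)) +
        (fun k => y (c, k)) ⬝ᵥ const (P c.other (slot i c.other)) +
        formalTaylor (perturbationJet S (slot i c) (P c)) fun k => y (c, k) :=
    (seriesSubst_slotPoint (slot i c) (P c) (fun k => hy (c, k)) hS).trans
      (hP c ▸ formalTaylor_slotJet _ _ (fun k => hy (c, k)) h0)
  have displace_eq (c : Colour) :
      displace i P y c = const (P c (slot i c)) + fun k => y (c, k) := rfl
  have const_dotProduct (a b : Fin d → ℝ) : const a ⬝ᵥ const b = PowerSeries.C (a ⬝ᵥ b) := by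
    simp only [dotProduct, const, map_sum, map_mul]
  have critical : criticalValue (bipartitePairing (Fin d)) (sideJet S i P) y =
      ∑ c, formalTaylor (perturbationJet S (slot i c) (P c)) (fun k => y (c, k)) -
        (fun k => y (.white, k)) ⬝ᵥ (fun k => y (.black, k)) :=
    IsCriticalPoint.criticalValue_bipartitePairing h
  -- The terms linear in `y` cancel between the Taylor expansions of `S₀` and the pairing.
  rw [sideValue, critical, Fintype.sum_congr _ _ value]
  simp only [Colour.sum_eq, Colour.other, displace_eq, add_dotProduct, dotProduct_add,
    const_dotProduct, map_add, map_sub]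
  rw [dotProduct_comm (const _) (fun k => y (.black, k))]
  ring

end Sides

section SGA

variable {d : ℕ} {S : ℕ → B₂ d → ℝ} (h0 : S 0 = bilinearForm) (hS : ∀ n, ContDiff ℝ ∞ (S n))
  (p₁ p₂ p₃ x : Fin d → ℝ) (i : Side)

include h0 hS

theorem exists_isSolution : ∃ u, IsSolution S i (basePoint p₁ p₂ p₃ x i) u := by
  obtain ⟨y, hy, -⟩ := existsUnique_isCriticalPoint (bipartitePairing (Fin d))
    (X_dvd_sideJet S i (basePoint p₁ p₂ p₃ x i))
  exact ⟨_, (isSolution_displace_iff h0 (bilinearGrad_basePoint p₁ p₂ p₃ x i) hS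
    (hy.X_dvd (X_dvd_sideJet S i _))).2 hy⟩

variable {p₁ p₂ p₃ x i} {u : Colour → Fin d → ℝ⟦X⟧}
  (hu : IsSolution S i (basePoint p₁ p₂ p₃ x i) u)

include hu

theorem IsSolution.exists_sideValue_eq :
    ∃ y, IsCriticalPoint (bipartitePairing (Fin d)) (sideJet S i (basePoint p₁ p₂ p₃ x i)) y ∧
      sideValue S i (basePoint p₁ p₂ p₃ x i) u = PowerSeries.C (x ⬝ᵥ (p₁ + p₂ + p₃)) +
        criticalValue (bipartitePairing (Fin d)) (sideJet S i (basePoint p₁ p₂ p₃ x i)) y := by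
  have hP := bilinearGrad_basePoint p₁ p₂ p₃ x i
  obtain ⟨y, hy, rfl⟩ := hu.exists_displace h0 hP
  have critical := (isSolution_displace_iff h0 hP hS hy).1 hu
  exact ⟨y, critical, by
    rw [critical.sideValue_displace h0 hP hS, sum_bilinearForm_basePoint]⟩

theorem IsSolution.coeff_zero_sideValue :
    coeff 0 (sideValue S i (basePoint p₁ p₂ p₃ x i) u) = x ⬝ᵥ (p₁ + p₂ + p₃) := by
  obtain ⟨y, hy, value⟩ := hu.exists_sideValue_eq h0 hS
  rw [value, map_add, coeff_zero_C, coeff_criticalValue_eq_sum (isSymm_bipartitePairing _)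
    (X_dvd_sideJet S i _) hy, Finset.Icc_eq_empty_of_lt one_pos, Finset.sum_empty, add_zero]

theorem IsSolution.coeff_sideValue {n : ℕ} (hn : 0 < n) :
    coeff n (sideValue S i (basePoint p₁ p₂ p₃ x i) u) =
      ∑ k ∈ Finset.Icc 1 n, ∑ t : BipartiteTree k, (1 / ((k ! : ℕ) : ℝ)) *
        ∑ ν ∈ compositions k n, C i t (fun v => S (ν v)) p₁ p₂ p₃ x := by
  obtain ⟨y, hy, value⟩ := hu.exists_sideValue_eq h0 hS
  rw [value, map_add, coeff_C, if_neg hn.ne', zero_add,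
    coeff_criticalValue_eq_sum (isSymm_bipartitePairing _) (X_dvd_sideJet S i _) hy]
  refine Finset.sum_congr rfl fun k _ => ?_
  have trees := coeff_treeContraction_positivePart (k := k) (fun c n l =>
    jet (S n) (basePoint p₁ p₂ p₃ x i c) (l.map (Prod.mk (slot i c)))) n
  simp only [Multiset.map_coe, List.map_map, jet_coe (hS _)] at trees
  rw [← Finset.mul_sum, one_div, Rat.smul_def, Rat.cast_inv, Rat.cast_natCast]
  exact congrArg _ trees

end SGA

end SGA

end

theorem mainTheorem2 (d : ℕ) (S : ℕ → SGA.B₂ d → ℝ)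
    (hS₀ : ∀ p₁ p₂ x : Fin d → ℝ, S 0 ![p₁, p₂, x] = x ⬝ᵥ (p₁ + p₂))
    (hS : ∀ n, 1 ≤ n → ContDiff ℝ ∞ (S n)) :
    SGA.Satisfies S ↔
      ∀ n : ℕ, 0 < n → ∀ p₁ p₂ p₃ x : Fin d → ℝ,
        ∑ k ∈ Finset.Icc 1 n, ∑ t : SGA.BipartiteTree k, (1 / ((k ! : ℕ) : ℝ)) *
          ∑ ν ∈ SGA.compositions k n,
            (SGA.C .first t (fun v => S (ν v)) p₁ p₂ p₃ x -
              SGA.C .second t (fun v => S (ν v)) p₁ p₂ p₃ x) = 0 := by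
  have h0 : S 0 = SGA.bilinearForm := funext fun y => by
    have slots : y = ![y 0, y 1, y 2] := by
      funext s
      fin_cases s <;> rfl
    rw [slots, hS₀]
    rfl
  have smooth (n : ℕ) : ContDiff ℝ ∞ (S n) := by
    rcases n.eq_zero_or_pos with rfl | hn
    exacts [h0 ▸ SGA.contDiff_bilinearForm, hS n hn]
  simp only [SGA.satisfies_iff_exists_isSolution, Finset.sum_sub_distrib, mul_sub, sub_eq_zero]
  constructor
  · intro h n hn p₁ p₂ p₃ x
    obtain ⟨u, v, hu, hv, huv⟩ := h p₁ p₂ p₃ x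
    rw [← hu.coeff_sideValue h0 smooth hn, huv, hv.coeff_sideValue h0 smooth hn]
  · intro h p₁ p₂ p₃ x
    obtain ⟨u, hu⟩ := SGA.exists_isSolution h0 smooth p₁ p₂ p₃ x .first
    obtain ⟨v, hv⟩ := SGA.exists_isSolution h0 smooth p₁ p₂ p₃ x .second
    refine ⟨u, v, hu, hv, PowerSeries.ext fun n => ?_⟩
    rcases n.eq_zero_or_pos with rfl | hn
    · rw [hu.coeff_zero_sideValue h0 smooth, hv.coeff_zero_sideValue h0 smooth]
    · rw [hu.coeff_sideValue h0 smooth hn, hv.coeff_sideValue h0 smooth hn, h n hn]
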